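/- Let $n\ge 1$ and $0<\gamma\le 1$, and let $|\cdot|$ be the $\ell_\infty$-norm on $\mathbb R^n$. There is a constant $c_{n,\gamma}$, depending only on $n$ and $\gamma$, with the following property. Let $A\ge 1$, and let $T$ be a bounded linear operator on $L_2=L_2(\mathbb R^n;\mathbb C)$ with $\|T\|_{\mathcal B(L_2)}\le 1$ (in particular, $T$ may be $L_2$-normalized, $\|T\|_{\mathcal B(L_2)}=1$) which is a Calderón–Zygmund operator with Lipschitz parameter $\gamma$: there is a kernel $k(x,y)\in\mathbb C$, $x\ne y$, such that $$|k(x,y)|\le \frac{A}{|x-y|^{n}},$$ $$|k(x,y)-k(x',y)|\le \frac{A\,|x-x'|^\gamma}{|x-y|^{n+\gamma}}\ \text{ if } |x-x'|\le\tfrac12|x-y|,\qquad |k(x,y)-k(x,y')|\le \frac{A\,|y-y'|^\gamma}{|x-y|^{n+\gamma}}\ \text{ if } |y-y'|\le\tfrac12|x-y|,$$ and, for every smooth compactly supported $f$, $Tf(x)=\int_{\mathbb R^n} k(x,y)f(y)\,dy$ for almost every $x\notin\operatorname{supp} f$. For $k\in\mathbb Z$ let $\mathsf E_k$ be the conditional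 expectation onto the $\sigma$-algebra generated by the dyadic cubes $\prod_{i=1}^n[m_i2^{-k},(m_i+1)2^{-k})$, $m\in\mathbb Z^n$, let $\Delta_k=\mathsf E_k-\mathsf E_{k-1}$, and for $\varepsilon>0$ let $T_\varepsilon f(x)=\int_{|x-y|>\varepsilon}k(x,y)f(y)\,dy$. Let $s\ge1$ be an integer. 1. Assume that $T^*1=0$, that is, $\int_{\mathbb R^n}Tf(x)\,dx=0$ for every $f\in H_1(\mathbb R^n)\cap L_2(\mathbb R^n)$, where $H_1$ is the (atomic) Hardy space. Then for each $f\in L_2$ the series $\Phi_sf=\sum_{k\in\mathbb Z}\mathsf E_kT\Delta_{k+s}f$ converges unconditionally in $L_2$, and $$\|\Phi_s\|_{\mathcal B(L_2)}\le c_{n,\gamma}\,A\,s\,2^{-\gamma s/4}.$$ 2. Without any assumption on $T^*1$: for each $f\in L_2$ and $k\in\mathbb Z$ the integral $T_{4\cdot2^{-k}}\Delta_{k+s}f(x)$ converges absolutely for every $x$ and defines a function in $L_2$, the series $\Psi_sf=\sum_{k\in\mathbb Z}(\mathrm{id}-\mathsf E_k)T_{4\cdot2^{-k}}\Delta_{k+s}f$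 converges unconditionally in $L_2$, and $$\|\Psi_s\|_{\mathcal B(L_2)}\le c_{n,\gamma}\,A\,2^{-\gamma s/2}.$$ -/

import Mathlib

open MeasureTheory Filter Topology
open scoped ContDiff

noncomputable section

/- `Fin n → ℝ` carries Lebesgue measure and the sup (`ℓ_∞`) distance,
which is the distance on `ℝⁿ` used everywhere below. -/

/-- The complex Hilbert space `L₂(ℝⁿ)`. -/
abbrev L2 (n : ℕ) : Type := Lp ℂ 2 (volume : Measure (Fin n → ℝ))

/-- The dyadic cube of side length `2⁻ᵏ` with lower corner `2⁻ᵏ m`. -/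
def dyadicCube {n : ℕ} (k : ℤ) (m : Fin n → ℤ) : Set (Fin n → ℝ) :=
  Set.univ.pi fun i => Set.Ico ((m i : ℝ) * (2 : ℝ) ^ (-k)) (((m i : ℝ) + 1) * (2 : ℝ) ^ (-k))

/-- The `k`-th σ-algebra of the standard dyadic filtration, generated by the
dyadic cubes of side length `2⁻ᵏ`. -/
@[reducible] def dyadicSigma (n : ℕ) (k : ℤ) : MeasurableSpace (Fin n → ℝ) :=
  MeasurableSpace.generateFrom (Set.range (dyadicCube (n := n) k))

theorem dyadicSigma_le (n : ℕ) (k : ℤ) :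
    dyadicSigma n k ≤ (inferInstance : MeasurableSpace (Fin n → ℝ)) := by
  refine MeasurableSpace.generateFrom_le ?_
  rintro _ ⟨m, rfl⟩
  exact MeasurableSet.univ_pi fun i => measurableSet_Ico

/-- The dyadic conditional expectation `E_k` on `L₂(ℝⁿ)`. -/
def dyadicExp (n : ℕ) (k : ℤ) : L2 n →L[ℂ] L2 n :=
  (lpMeas ℂ ℂ (dyadicSigma n k) 2 (volume : Measure (Fin n → ℝ))).subtypeL.comp
    (condExpL2 ℂ ℂ (dyadicSigma_le n k))

/-- The dyadic martingale difference operator `Δ_k = E_k - E_{k-1}` on `L₂(ℝⁿ)`. -/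
def dyadicDiff (n : ℕ) (k : ℤ) : L2 n →L[ℂ] L2 n :=
  dyadicExp n k - dyadicExp n (k - 1)

/-- `T` is an `L₂`-bounded Calderón-Zygmund operator associated to the kernel `K`,
with Lipschitz smoothness parameter `γ` and with constant `A` in the size and smoothness
estimates. Only the values of `K` off the diagonal matter. -/
structure IsCalderonZygmund {n : ℕ} (γ A : ℝ) (K : (Fin n → ℝ) → (Fin n → ℝ) → ℂ)
    (T : L2 n →L[ℂ] L2 n) : Prop where
  size : ∀ x y, x ≠ y → ‖K x y‖ ≤ A / dist x y ^ n
  smooth_left : ∀ x x' y, x ≠ y → dist x x' ≤ dist x y / 2 →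
    ‖K x y - K x' y‖ ≤ A * dist x x' ^ γ / dist x y ^ ((n : ℝ) + γ)
  smooth_right : ∀ x y y', x ≠ y → dist y y' ≤ dist x y / 2 →
    ‖K x y - K x y'‖ ≤ A * dist y y' ^ γ / dist x y ^ ((n : ℝ) + γ)
  kernel : ∀ (φ : (Fin n → ℝ) → ℂ) (f : L2 n), ContDiff ℝ ∞ φ → HasCompactSupport φ →
    f =ᵐ[volume] φ → ∀ᵐ x, x ∉ tsupport φ → T f x = ∫ y, K x y * φ y

/-- `a` is an `L_∞`-atom of the Hardy space `H₁(ℝⁿ)`. (Balls for the sup distance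
are cubes.) -/
def IsHardyAtom {n : ℕ} (a : (Fin n → ℝ) → ℂ) : Prop :=
  AEStronglyMeasurable a volume ∧
  (∃ (z : Fin n → ℝ) (r : ℝ), 0 < r ∧ Function.support a ⊆ Metric.closedBall z r ∧
    ∀ᵐ x, ‖a x‖ ≤ (volume.real (Metric.closedBall z r))⁻¹) ∧
  ∫ x, a x = 0

/-- Membership in the Hardy space `H₁(ℝⁿ)`: `f = ∑ⱼ cⱼ aⱼ` in `L₁`, with atoms `aⱼ`
and `∑ⱼ |cⱼ| < ∞`. -/
def MemHardyOne {n : ℕ} (f : (Fin n → ℝ) → ℂ) : Prop :=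
  Integrable f volume ∧
  ∃ (c : ℕ → ℂ) (a : ℕ → (Fin n → ℝ) → ℂ),
    (∀ j, IsHardyAtom (a j)) ∧ (Summable fun j => ‖c j‖) ∧
    Tendsto (fun N => eLpNorm (fun x => f x - ∑ j ∈ Finset.range N, c j * a j x) 1 volume)
      atTop (𝓝 0)

/-- The cancellation condition `T*1 = 0`: `∫ T f = 0` for `f` in `H₁`. It is imposed on those
`f` for which `T f` is given by the `L₂` operator; they contain all atoms, and for a
Calderón-Zygmund operator `T f` is then integrable. -/
def AdjointKillsOne {n : ℕ} (T : L2 n →L[ℂ] L2 n) : Prop :=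
  ∀ f : L2 n, MemHardyOne (f : (Fin n → ℝ) → ℂ) → ∫ x, T f x = 0

/-- `g = T_ε f`, where `T_ε f (x) = ∫_{|x-y|>ε} K(x,y) f(y) dy` is the truncated singular
integral; the integral has to converge absolutely and its value has to be in `L₂`. -/
def IsTruncatedIntegral {n : ℕ} (K : (Fin n → ℝ) → (Fin n → ℝ) → ℂ) (ε : ℝ)
    (f g : L2 n) : Prop :=
  (∀ x, IntegrableOn (fun y => K x y * f y) {y | ε < dist x y} volume) ∧
  ∀ᵐ x, g x = ∫ y in {y | ε < dist x y}, K x y * f y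

end

/-! Both series are sums of almost orthogonal terms `Λ_k f` whose size is measured by `‖Δ_{k+s} f‖`
instead of `‖f‖`. If `|⟨Λ_i f, Λ_j f⟩| ≤ B r^|i-j| ‖Δ_{i+s} f‖ ‖Δ_{j+s} f‖` with `r < 1`, then
finite sums are controlled by `∑ ‖Δ_{k+s} f‖²`. Bessel's inequality for martingale differences then
gives unconditional convergence and an operator bound of order `√B`
(`exists_hasSum_of_almostOrthogonal`). It remains to find the decay of the inner products.

For `Ψ`, write `G_k = T_ε Δ_{k+s}` with `ε = 4·2⁻ᵏ`. Moving one variable of the truncated kernel by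
`δ ≤ ε/4` changes it by at most `A` times a convolution kernel of mass about `(δ/ε)^γ`
(`norm_truncKernel_sub_le`, `lintegral_shellKernel_le`). By Schur's test, motion in `y` and the mean
zero of `Δ_{k+s} f` on cubes give `‖G_k f‖ ≲ A 2^{-γs} ‖Δ_{k+s} f‖`. Motion in `x` gives `‖(id -
E_j) G_k f‖ ≲ A 2^{-γ(j-k)} ‖Δ_{k+s} f‖` for `j ≥ k`. For `i ≤ j` the projection `id - E_j` may be
placed on both factors, so the inner product gains `2^{-γ(j-i)}` from one factor and `2^{-γs}` from
the other. Thus `B ~ A² 2^{-γs}`, whose root is `A 2^{-γs/2}`.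

For `Φ`, the point is `‖E_k T Δ_{k+d} f‖ ≲ A 2^{-γd/4} ‖Δ_{k+d} f‖`; for `i ≤ j`, `E_i E_j = E_i`
replaces the gap `s` of the finer term by `s + (j - i)`. Put `h = Δ_{k+d} f` and `F = E_k T h`, so
`‖F‖² = ⟨F, T h⟩`. Cut `h` into its pieces `h_R` on the cubes `R` of side `ρ = 2^{-(k+d-1)}`. Each
piece is a multiple of an atom, so `∫ T h_R = 0` and `F` may be replaced by `F - F|_R`. Using the
`L₂` bound near `R`, kernel smoothness far from it, and Young's inequality with weight `t`, the sum
over `R` is at most `A` times `t ∬ |F(x) - F(y)|² ρ^γ (ρ + |x - y|)^{-n-γ} + t⁻¹ ‖h‖²`, up to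
constants (`enorm_inner_apply_le`). As `F` is a step function on cubes of side `2⁻ᵏ`, the double
integral is `≲ (ρ 2ᵏ)^{γ/2} ‖F‖²`: a translation by `z` only affects points within `|z|` of a cube's
boundary. Choosing `t` to absorb half of `‖F‖²` and taking a root gives the exponent `γ/4`. -/

/-! ### Dyadic cubes -/

/-- The index `m` of the dyadic cube of side length `2⁻ᵏ` that contains `x`. -/
noncomputable def dyadicIndex {n : ℕ} (k : ℤ) (x : Fin n → ℝ) : Fin n → ℤ := fun i => ⌊x i * (2 : ℝ) ^ k⌋

/-- The lower corner of the dyadic cube with index `m`. -/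
noncomputable def dyadicPoint {n : ℕ} (k : ℤ) (m : Fin n → ℤ) : Fin n → ℝ :=
  fun i => (m i : ℝ) * (2 : ℝ) ^ (-k)

/-- The lower corner of the dyadic cube of side length `2⁻ᵏ` that contains `x`. -/
noncomputable def dyadicCorner {n : ℕ} (k : ℤ) (x : Fin n → ℝ) : Fin n → ℝ :=
  dyadicPoint k (dyadicIndex k x)

section Geometry

variable {n : ℕ}

theorem mem_dyadicCube_iff {k : ℤ} {m : Fin n → ℤ} {x : Fin n → ℝ} :
    x ∈ dyadicCube k m ↔ dyadicIndex k x = m := by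
  have h2 : (0 : ℝ) < 2 ^ k := by positivity
  simp only [dyadicCube, Set.mem_univ_pi, Set.mem_Ico, funext_iff, dyadicIndex, Int.floor_eq_iff,
    zpow_neg, ← div_eq_mul_inv, div_le_iff₀ h2, lt_div_iff₀ h2]

theorem dyadicCube_eq_preimage (k : ℤ) (m : Fin n → ℤ) :
    dyadicCube k m = dyadicIndex k ⁻¹' {m} := by
  ext x; exact mem_dyadicCube_iff

/-- The cubes are the fibres of `dyadicIndex k` and `ℤⁿ` is countable. Hence measurable functions at
level `k` are exactly the functions of the index. -/
theorem dyadicSigma_eq_comap (k : ℤ) :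
    dyadicSigma n k = MeasurableSpace.comap (dyadicIndex k) ⊤ := by
  apply le_antisymm
  · refine MeasurableSpace.generateFrom_le ?_
    rintro _ ⟨m, rfl⟩
    exact ⟨{m}, trivial, (dyadicCube_eq_preimage k m).symm⟩
  · rintro _ ⟨S, -, rfl⟩
    rw [← Set.biUnion_of_singleton S, Set.preimage_iUnion₂]
    refine @MeasurableSet.biUnion _ _ (dyadicSigma n k) _ _ S.to_countable fun m _ => ?_
    rw [← dyadicCube_eq_preimage]
    exact MeasurableSpace.measurableSet_generateFrom ⟨m, rfl⟩

theorem measurableSet_dyadicCube (k : ℤ) (m : Fin n → ℤ) : MeasurableSet (dyadicCube k m) :=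
  MeasurableSet.univ_pi fun _ => measurableSet_Ico

theorem measurable_dyadicIndex (k : ℤ) :
    @Measurable _ _ (dyadicSigma n k) ⊤ (dyadicIndex k) := by
  rw [dyadicSigma_eq_comap]
  exact comap_measurable _

theorem stronglyMeasurable_comp_dyadicIndex {E : Type*} [NormedAddCommGroup E] (k : ℤ)
    (F : (Fin n → ℤ) → E) :
    StronglyMeasurable[dyadicSigma n k] (fun x => F (dyadicIndex k x)) := by
  let _ : MeasurableSpace (Fin n → ℤ) := ⊤
  have : StronglyMeasurable F :=
    StronglyMeasurable.of_discrete
  exact this.comp_measurable (measurable_dyadicIndex k)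

theorem eq_of_dyadicIndex_eq {E : Type*} [NormedAddCommGroup E] {k : ℤ} {F : (Fin n → ℝ) → E}
    (hF : StronglyMeasurable[dyadicSigma n k] F) {x y : Fin n → ℝ}
    (hxy : dyadicIndex k x = dyadicIndex k y) : F x = F y := by
  let _ : MeasurableSpace E := borel E
  have _ : BorelSpace E := ⟨rfl⟩
  have h1 : MeasurableSet[dyadicSigma n k] (F ⁻¹' {F y}) :=
    hF.measurable (measurableSet_singleton _)
  rw [dyadicSigma_eq_comap] at h1
  obtain ⟨S, -, hS⟩ := h1
  have hy : y ∈ F ⁻¹' {F y} := rfl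
  rw [← hS, Set.mem_preimage, ← hxy] at hy
  have : x ∈ F ⁻¹' {F y} := by rw [← hS]; exact hy
  exact this

/-- Nestedness of the grids: the coarse floor is the integer quotient of the fine floor by `2^d`. -/
theorem dyadicIndex_eq_of_le {j k : ℤ} (hjk : j ≤ k) {x y : Fin n → ℝ}
    (hxy : dyadicIndex k x = dyadicIndex k y) : dyadicIndex j x = dyadicIndex j y := by
  obtain ⟨d, rfl⟩ := Int.le.dest hjk
  funext i
  have key : ∀ t : ℝ, ⌊t * (2 : ℝ) ^ j⌋ = ⌊t * (2 : ℝ) ^ (j + (d : ℤ))⌋ / ((2 ^ d : ℕ) : ℤ) := by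
    intro t
    rw [← Int.floor_div_natCast, zpow_add₀ two_ne_zero, zpow_natCast]
    congr 1
    push_cast
    field_simp
  have := congrFun hxy i
  simp only [dyadicIndex] at this ⊢
  rw [key, key, this]

theorem dyadicSigma_mono {j k : ℤ} (hjk : j ≤ k) : dyadicSigma n j ≤ dyadicSigma n k := by
  rw [dyadicSigma_eq_comap j, dyadicSigma_eq_comap k]
  rintro _ ⟨S, -, rfl⟩
  refine ⟨dyadicIndex k '' (dyadicIndex j ⁻¹' S), trivial, ?_⟩
  ext x
  constructor
  · rintro ⟨y, hy, hyx⟩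
    have := dyadicIndex_eq_of_le hjk hyx
    simpa only [Set.mem_preimage, this] using hy
  · intro hx
    exact ⟨x, hx, rfl⟩

theorem dyadicIndex_dyadicPoint (k : ℤ) (m : Fin n → ℤ) : dyadicIndex k (dyadicPoint k m) = m := by
  funext i
  simp only [dyadicIndex, dyadicPoint]
  rw [mul_assoc, ← zpow_add₀ two_ne_zero, neg_add_cancel, zpow_zero, mul_one, Int.floor_intCast]

theorem dyadicIndex_dyadicCorner (k : ℤ) (x : Fin n → ℝ) :
    dyadicIndex k (dyadicCorner k x) = dyadicIndex k x :=
  dyadicIndex_dyadicPoint _ _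

theorem dist_le_of_dyadicIndex_eq {k : ℤ} {x y : Fin n → ℝ}
    (hxy : dyadicIndex k x = dyadicIndex k y) : dist x y ≤ (2 : ℝ) ^ (-k) := by
  rw [dist_pi_le_iff (by positivity)]
  intro i
  have h1 := congrFun hxy i
  simp only [dyadicIndex] at h1
  have h2 := Int.abs_sub_lt_one_of_floor_eq_floor h1
  have h3 : (0 : ℝ) < 2 ^ k := by positivity
  rw [← sub_mul, abs_mul, abs_of_pos h3] at h2
  rw [Real.dist_eq, zpow_neg, ← one_div, le_div_iff₀ h3]
  exact h2.le

theorem dist_dyadicCorner (k : ℤ) (x : Fin n → ℝ) : dist x (dyadicCorner k x) ≤ (2 : ℝ) ^ (-k) :=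
  dist_le_of_dyadicIndex_eq (dyadicIndex_dyadicCorner k x).symm

theorem volume_dyadicCube (k : ℤ) (m : Fin n → ℤ) :
    volume (dyadicCube k m) = ENNReal.ofReal ((2 : ℝ) ^ (-k)) ^ n := by
  rw [dyadicCube, Real.volume_pi_Ico]
  have : ∀ i, ((m i : ℝ) + 1) * (2 : ℝ) ^ (-k) - (m i : ℝ) * 2 ^ (-k) = 2 ^ (-k) := fun i => by ring
  simp only [this, Finset.prod_const, Finset.card_univ, Fintype.card_fin]

/-- A step function at a fine level thus takes finitely many values on a given cube and is bounded
there, which is what an atom needs. -/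
theorem finite_dyadicIndex_image (j k : ℤ) (m : Fin n → ℤ) :
    (dyadicIndex k '' dyadicCube j m).Finite := by
  refine (Set.finite_Icc (fun i => ⌊((m i : ℝ) * (2 : ℝ) ^ (-j)) * 2 ^ k⌋)
    (fun i => ⌊(((m i : ℝ) + 1) * (2 : ℝ) ^ (-j)) * 2 ^ k⌋)).subset ?_
  rintro _ ⟨x, hx, rfl⟩
  have h3 : (0 : ℝ) < 2 ^ k := by positivity
  simp only [dyadicCube, Set.mem_univ_pi, Set.mem_Ico] at hx
  constructor <;> intro i <;> apply Int.floor_le_floor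
  · exact mul_le_mul_of_nonneg_right (hx i).1 h3.le
  · exact mul_le_mul_of_nonneg_right (hx i).2.le h3.le

theorem pairwise_disjoint_dyadicCube (k : ℤ) :
    Pairwise (Function.onFun Disjoint (dyadicCube (n := n) k)) := by
  intro m m' hm
  refine Set.disjoint_left.2 fun x hx hx' => hm ?_
  rw [mem_dyadicCube_iff] at hx hx'
  rw [← hx, hx']

theorem iUnion_dyadicCube (k : ℤ) : ⋃ m, dyadicCube (n := n) k m = Set.univ :=
  Set.eq_univ_of_forall fun _ => Set.mem_iUnion.2 ⟨_, mem_dyadicCube_iff.2 rfl⟩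

end Geometry

/-! ### Dyadic conditional expectations -/

section CondExp

variable {n : ℕ}

instance hasOrthogonalProjection_dyadicSigma (k : ℤ) :
    (lpMeas ℂ ℂ (dyadicSigma n k) 2
      (volume : Measure (Fin n → ℝ))).HasOrthogonalProjection :=
  have : Fact (dyadicSigma n k ≤ MeasurableSpace.pi) := ⟨dyadicSigma_le n k⟩
  inferInstance

theorem dyadicExp_eq_starProjection (k : ℤ) :
    dyadicExp n k = (lpMeas ℂ ℂ (dyadicSigma n k) 2 volume).starProjection := rfl

theorem aestronglyMeasurable_dyadicExp (k : ℤ) (f : L2 n) :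
    AEStronglyMeasurable[dyadicSigma n k] (dyadicExp n k f : (Fin n → ℝ) → ℂ) volume :=
  lpMeas.aestronglyMeasurable (condExpL2 ℂ ℂ (dyadicSigma_le n k) f)

theorem dyadicExp_of_aestronglyMeasurable {k : ℤ} {f : L2 n}
    (hf : AEStronglyMeasurable[dyadicSigma n k] (f : (Fin n → ℝ) → ℂ) volume) :
    dyadicExp n k f = f := by
  rw [dyadicExp_eq_starProjection, Submodule.starProjection_eq_self_iff]
  exact mem_lpMeas_iff_aestronglyMeasurable.2 hf

theorem inner_dyadicExp_left (k : ℤ) (f g : L2 n) :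
    inner ℂ (dyadicExp n k f) g = inner ℂ f (dyadicExp n k g) :=
  inner_condExpL2_left_eq_right (dyadicSigma_le n k)

theorem dyadicExp_dyadicExp_of_le {j k : ℤ} (hjk : j ≤ k) (f : L2 n) :
    dyadicExp n k (dyadicExp n j f) = dyadicExp n j f :=
  dyadicExp_of_aestronglyMeasurable
    ((aestronglyMeasurable_dyadicExp j f).mono (dyadicSigma_mono hjk))

theorem dyadicExp_dyadicExp_of_ge {j k : ℤ} (hjk : j ≤ k) (f : L2 n) :
    dyadicExp n j (dyadicExp n k f) = dyadicExp n j f := by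
  refine ext_inner_right ℂ fun g => ?_
  rw [inner_dyadicExp_left, inner_dyadicExp_left, dyadicExp_dyadicExp_of_le hjk,
    inner_dyadicExp_left]

/-- An orthogonal projection is the best approximation. This allows corner sampling, which is easy
to estimate by kernels, to stand in for averaging. -/
theorem norm_sub_dyadicExp_le_norm_sub {k : ℤ} (f : L2 n) {a : L2 n}
    (ha : AEStronglyMeasurable[dyadicSigma n k] (a : (Fin n → ℝ) → ℂ) volume) :
    ‖f - dyadicExp n k f‖ ≤ ‖f - a‖ := by
  rw [dyadicExp_eq_starProjection, Submodule.starProjection_minimal]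
  exact ciInf_le ⟨0, by rintro _ ⟨x, rfl⟩; positivity⟩
    (⟨a, mem_lpMeas_iff_aestronglyMeasurable.2 ha⟩ : lpMeas ℂ ℂ (dyadicSigma n k) 2 volume)

theorem inner_eq_zero_of_dyadicExp_eq_zero {k : ℤ} {b h : L2 n}
    (hb : AEStronglyMeasurable[dyadicSigma n k] (b : (Fin n → ℝ) → ℂ) volume)
    (hh : dyadicExp n k h = 0) : inner ℂ b h = 0 := by
  rw [← dyadicExp_of_aestronglyMeasurable hb, inner_dyadicExp_left, hh, inner_zero_right]

theorem integral_mul_eq_zero_of_dyadicExp_eq_zero {k : ℤ} {b : (Fin n → ℝ) → ℂ} {h : L2 n}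
    (hb : StronglyMeasurable[dyadicSigma n k] b) (hb2 : MemLp b 2 volume)
    (hh : dyadicExp n k h = 0) : ∫ y, b y * h y = 0 := by
  have hc : MemLp (fun y => starRingEnd ℂ (b y)) 2 volume := hb2.star
  have hcm : StronglyMeasurable[dyadicSigma n k] (fun y => starRingEnd ℂ (b y)) :=
    Complex.continuous_conj.comp_stronglyMeasurable hb
  have h1 : AEStronglyMeasurable[dyadicSigma n k] (hc.toLp _ : (Fin n → ℝ) → ℂ) volume :=
    ⟨_, hcm, hc.coeFn_toLp⟩
  have h2 := inner_eq_zero_of_dyadicExp_eq_zero h1 hh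
  rw [MeasureTheory.L2.inner_def] at h2
  rw [← h2]
  refine integral_congr_ae ?_
  filter_upwards [hc.coeFn_toLp] with y hy
  simp [hy, mul_comm]

theorem dyadicDiff_apply (k : ℤ) (f : L2 n) :
    dyadicDiff n k f = dyadicExp n k f - dyadicExp n (k - 1) f := rfl

theorem dyadicExp_dyadicDiff_of_lt {j k : ℤ} (hjk : j < k) (f : L2 n) :
    dyadicExp n j (dyadicDiff n k f) = 0 := by
  simp only [dyadicDiff, _root_.sub_apply, map_sub]
  rw [dyadicExp_dyadicExp_of_ge hjk.le, dyadicExp_dyadicExp_of_ge (by omega), sub_self]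

theorem dyadicExp_dyadicDiff_of_le {j k : ℤ} (hjk : k ≤ j) (f : L2 n) :
    dyadicExp n j (dyadicDiff n k f) = dyadicDiff n k f := by
  simp only [dyadicDiff, _root_.sub_apply, map_sub]
  rw [dyadicExp_dyadicExp_of_le hjk, dyadicExp_dyadicExp_of_le (by omega)]

theorem inner_dyadicDiff_left (k : ℤ) (f g : L2 n) :
    inner ℂ (dyadicDiff n k f) g = inner ℂ f (dyadicDiff n k g) := by
  simp only [dyadicDiff, _root_.sub_apply, inner_sub_left, inner_sub_right,
    inner_dyadicExp_left]

theorem dyadicDiff_dyadicDiff_self (k : ℤ) (f : L2 n) :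
    dyadicDiff n k (dyadicDiff n k f) = dyadicDiff n k f := by
  rw [dyadicDiff_apply, dyadicExp_dyadicDiff_of_le le_rfl,
    dyadicExp_dyadicDiff_of_lt (by omega), sub_zero]

theorem dyadicDiff_dyadicDiff_of_ne {j k : ℤ} (hjk : j ≠ k) (f : L2 n) :
    dyadicDiff n j (dyadicDiff n k f) = 0 := by
  rw [dyadicDiff_apply]
  rcases lt_or_gt_of_ne hjk with h | h
  · rw [dyadicExp_dyadicDiff_of_lt h, dyadicExp_dyadicDiff_of_lt (by omega), sub_zero]
  · rw [dyadicExp_dyadicDiff_of_le h.le, dyadicExp_dyadicDiff_of_le (by omega), sub_self]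

theorem inner_dyadicDiff_of_ne {j k : ℤ} (hjk : j ≠ k) (f g : L2 n) :
    inner ℂ (dyadicDiff n j f) (dyadicDiff n k g) = 0 := by
  rw [inner_dyadicDiff_left, dyadicDiff_dyadicDiff_of_ne hjk, inner_zero_right]

/-- Bessel's inequality for martingale differences. -/
theorem sum_norm_sq_dyadicDiff_le (S : Finset ℤ) (f : L2 n) :
    ∑ k ∈ S, ‖dyadicDiff n k f‖ ^ 2 ≤ ‖f‖ ^ 2 := by
  -- `⟨f, g⟩ = ⟨g, g⟩ = s`, so Cauchy–Schwarz reads `s ≤ ‖f‖ √s`.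
  set g : L2 n := ∑ k ∈ S, dyadicDiff n k f with hg
  have h1 : inner ℂ f g = ((∑ k ∈ S, ‖dyadicDiff n k f‖ ^ 2 : ℝ) : ℂ) := by
    rw [hg, inner_sum]
    push_cast
    refine Finset.sum_congr rfl fun k _ => ?_
    rw [← dyadicDiff_dyadicDiff_self, ← inner_dyadicDiff_left, inner_self_eq_norm_sq_to_K,
      dyadicDiff_dyadicDiff_self]
    rfl
  have h2 : inner ℂ g g = ((∑ k ∈ S, ‖dyadicDiff n k f‖ ^ 2 : ℝ) : ℂ) := by
    rw [hg, sum_inner]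
    push_cast
    refine Finset.sum_congr rfl fun k hk => ?_
    rw [inner_sum, Finset.sum_eq_single k (fun j _ hj => inner_dyadicDiff_of_ne hj.symm _ _)
      (fun h => absurd hk h), inner_self_eq_norm_sq_to_K]
    rfl
  set s := ∑ k ∈ S, ‖dyadicDiff n k f‖ ^ 2 with hs
  have hs0 : 0 ≤ s := Finset.sum_nonneg fun _ _ => by positivity
  have h3 : ‖g‖ ^ 2 = s := by
    rw [inner_self_eq_norm_sq_to_K] at h2
    exact Complex.ofReal_injective (by rw [Complex.ofReal_pow]; exact h2)
  have h4 : s ≤ ‖f‖ * ‖g‖ := by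
    have := norm_inner_le_norm (𝕜 := ℂ) f g
    rw [h1, Complex.norm_real, Real.norm_of_nonneg hs0] at this
    exact this
  nlinarith [sq_nonneg (‖f‖ - ‖g‖), norm_nonneg f, norm_nonneg g]

end CondExp

/-! ### Almost orthogonal series -/

section AlmostOrthogonal

/-- Schur's test on `ℤ`: apply `2 u_i u_j ≤ u_i² + u_j²` and sum rows. The factor 2 is there because
each distance `|i - j|` occurs at most twice in a row. -/
theorem sum_sum_geometric_mul_le {r : ℝ} (hr0 : 0 ≤ r) (hr1 : r < 1) (S : Finset ℤ) (u : ℤ → ℝ) :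
    ∑ i ∈ S, ∑ j ∈ S, r ^ (i - j).natAbs * (u i * u j) ≤ 2 / (1 - r) * ∑ i ∈ S, u i ^ 2 := by
  have hgeo : ∀ i : ℤ, ∑ j ∈ S, r ^ (i - j).natAbs ≤ 2 / (1 - r) := by
    intro i
    have hr1' : 0 < 1 - r := by linarith
    have hsum : HasSum (fun d : ℕ => r ^ d) (1 - r)⁻¹ := hasSum_geometric_of_lt_one hr0 hr1
    have half : ∀ U : Finset ℤ, (Set.InjOn (fun j : ℤ => (i - j).natAbs) U) →
        ∑ j ∈ U, r ^ (i - j).natAbs ≤ (1 - r)⁻¹ := by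
      intro U hU
      rw [← Finset.sum_image (f := fun d : ℕ => r ^ d) hU]
      exact sum_le_hasSum _ (fun _ _ => by positivity) hsum
    rw [← Finset.sum_filter_add_sum_filter_not S (fun j => j ≤ i)]
    have h1 := half (S.filter fun j => j ≤ i) (by
      intro a ha b hb hab
      simp only [Finset.coe_filter, Set.mem_ofPred_eq] at ha hb hab
      omega)
    have h2 := half (S.filter fun j => ¬ j ≤ i) (by
      intro a ha b hb hab
      simp only [Finset.coe_filter, Set.mem_ofPred_eq] at ha hb hab
      omega)
    rw [div_eq_mul_inv]
    linarith
  calc ∑ i ∈ S, ∑ j ∈ S, r ^ (i - j).natAbs * (u i * u j)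
      ≤ ∑ i ∈ S, ∑ j ∈ S, (r ^ (i - j).natAbs * u i ^ 2 / 2 + r ^ (j - i).natAbs * u j ^ 2 / 2) := by
        refine Finset.sum_le_sum fun i _ => Finset.sum_le_sum fun j _ => ?_
        have : (j - i).natAbs = (i - j).natAbs := by omega
        rw [this]
        have hp : 0 ≤ r ^ (i - j).natAbs := by positivity
        nlinarith [mul_nonneg hp (sq_nonneg (u i - u j))]
    _ = ∑ i ∈ S, (∑ j ∈ S, r ^ (i - j).natAbs) * u i ^ 2 := by
        simp only [Finset.sum_add_distrib]
        rw [Finset.sum_comm (f := fun i j => r ^ (j - i).natAbs * u j ^ 2 / 2),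
          ← Finset.sum_add_distrib]
        refine Finset.sum_congr rfl fun i _ => ?_
        rw [← Finset.sum_add_distrib, Finset.sum_mul]
        exact Finset.sum_congr rfl fun j _ => by ring
    _ ≤ ∑ i ∈ S, 2 / (1 - r) * u i ^ 2 := by
        gcongr with i hi
        exact hgeo i
    _ = _ := by rw [Finset.mul_sum]

variable {H : Type*} [NormedAddCommGroup H] [InnerProductSpace ℂ H]

theorem norm_sq_sum_le_of_inner_le {S : Finset ℤ} {v : ℤ → H} {u : ℤ → ℝ} {B r : ℝ} (hB : 0 ≤ B)
    (hr0 : 0 ≤ r) (hr1 : r < 1)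
    (h : ∀ i j, i ≤ j → ‖inner ℂ (v i) (v j)‖ ≤ B * r ^ (i - j).natAbs * (u i * u j)) :
    ‖∑ i ∈ S, v i‖ ^ 2 ≤ 2 * B / (1 - r) * ∑ i ∈ S, u i ^ 2 := by
  have h' : ∀ i j, ‖inner ℂ (v i) (v j)‖ ≤ B * r ^ (i - j).natAbs * (u i * u j) := by
    intro i j
    rcases le_total i j with hij | hij
    · exact h i j hij
    · have := h j i hij
      rw [norm_inner_symm] at this
      have e : (j - i).natAbs = (i - j).natAbs := by omega
      rwa [e, mul_comm (u j)] at this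
  have h2 : ‖∑ i ∈ S, v i‖ ^ 2 ≤ ∑ i ∈ S, ∑ j ∈ S, ‖inner ℂ (v i) (v j)‖ := by
    rw [← inner_self_eq_norm_sq (𝕜 := ℂ), sum_inner]
    refine (RCLike.re_le_norm _).trans ((norm_sum_le _ _).trans (Finset.sum_le_sum fun i _ => ?_))
    rw [inner_sum]
    exact norm_sum_le _ _
  calc ‖∑ i ∈ S, v i‖ ^ 2 ≤ ∑ i ∈ S, ∑ j ∈ S, ‖inner ℂ (v i) (v j)‖ := h2
    _ ≤ ∑ i ∈ S, ∑ j ∈ S, B * (r ^ (i - j).natAbs * (u i * u j)) := by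
        refine Finset.sum_le_sum fun i _ => Finset.sum_le_sum fun j _ => ?_
        rw [← mul_assoc]
        exact h' i j
    _ = B * ∑ i ∈ S, ∑ j ∈ S, r ^ (i - j).natAbs * (u i * u j) := by
        simp only [Finset.mul_sum]
    _ ≤ B * (2 / (1 - r) * ∑ i ∈ S, u i ^ 2) :=
        mul_le_mul_of_nonneg_left (sum_sum_geometric_mul_le hr0 hr1 S u) hB
    _ = _ := by ring

/-- Summation of almost orthogonal operators. -/
theorem exists_hasSum_of_almostOrthogonal [CompleteSpace H] {Λ D : ℤ → H →L[ℂ] H} {B r M : ℝ}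
    (hB : 0 ≤ B) (hr0 : 0 ≤ r) (hr1 : r < 1) (hM : 0 ≤ M) (hBM : 2 * B / (1 - r) ≤ M ^ 2)
    (hD : ∀ (S : Finset ℤ) (f : H), ∑ k ∈ S, ‖D k f‖ ^ 2 ≤ ‖f‖ ^ 2)
    (h : ∀ i j, i ≤ j → ∀ f, ‖inner ℂ (Λ i f) (Λ j f)‖ ≤
      B * r ^ (i - j).natAbs * (‖D i f‖ * ‖D j f‖)) :
    ∃ Φ : H →L[ℂ] H, (∀ f, HasSum (fun k => Λ k f) (Φ f)) ∧ ‖Φ‖ ≤ M := by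
  -- The right side is a partial sum of a convergent series, so this one estimate gives both the
  -- Cauchy criterion and the norm bound.
  have key : ∀ (S : Finset ℤ) f, ‖∑ i ∈ S, Λ i f‖ ^ 2 ≤ M ^ 2 * ∑ i ∈ S, ‖D i f‖ ^ 2 := by
    intro S f
    refine (norm_sq_sum_le_of_inner_le (u := fun i => ‖D i f‖) hB hr0 hr1
      (fun i j hij => h i j hij f)).trans ?_
    gcongr
  have hsum : ∀ f, Summable (fun k => Λ k f) := by
    intro f
    have hs : Summable (fun k => ‖D k f‖ ^ 2) :=
      summable_of_sum_le (fun _ => by positivity) (fun S => hD S f)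
    rw [summable_iff_vanishing_norm] at hs ⊢
    intro ε hε
    -- `M + 1` because `M = 0` is allowed.
    obtain ⟨S, hS⟩ := hs ((ε / (M + 1)) ^ 2) (by positivity)
    refine ⟨S, fun U hU => ?_⟩
    have h1 := hS U hU
    rw [Real.norm_of_nonneg (Finset.sum_nonneg fun _ _ => by positivity)] at h1
    have h2 := key U f
    have h3 : ‖∑ i ∈ U, Λ i f‖ ^ 2 < ε ^ 2 := by
      calc _ ≤ M ^ 2 * ∑ i ∈ U, ‖D i f‖ ^ 2 := h2
        _ ≤ M ^ 2 * (ε / (M + 1)) ^ 2 := by gcongr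
        _ = (M / (M + 1)) ^ 2 * ε ^ 2 := by field_simp
        _ < 1 * ε ^ 2 := by
          gcongr
          rw [div_pow, div_lt_one (by positivity)]
          nlinarith
        _ = ε ^ 2 := one_mul _
    exact lt_of_pow_lt_pow_left₀ 2 hε.le h3
  have hbound : ∀ f, ‖∑' k, Λ k f‖ ≤ M * ‖f‖ := by
    intro f
    refine le_of_tendsto ((hsum f).hasSum.norm) (Eventually.of_forall fun S => ?_)
    refine le_of_sq_le_sq ?_ (by positivity)
    rw [mul_pow]
    exact (key S f).trans (mul_le_mul_of_nonneg_left (hD S f) (by positivity))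
  let Φ₀ : H →ₗ[ℂ] H :=
    { toFun := fun f => ∑' k, Λ k f
      map_add' := fun f g => by
        simp only [map_add]
        exact (hsum f).tsum_add (hsum g)
      map_smul' := fun c f => by
        simp only [map_smul, RingHom.id_apply]
        exact (hsum f).tsum_const_smul c }
  exact ⟨Φ₀.mkContinuous M hbound, fun f => (hsum f).hasSum,
    LinearMap.mkContinuous_norm_le _ hM _⟩

end AlmostOrthogonal

/-! ### Convolution kernels -/

section Kernels

variable {n : ℕ}

/-- The radial kernel `ρ^γ / (ρ + |z|)^(n + γ)`. -/
noncomputable def bracketKernel (n : ℕ) (γ ρ : ℝ) (z : Fin n → ℝ) : ℝ :=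
  ρ ^ γ / (ρ + ‖z‖) ^ ((n : ℝ) + γ)

/-- The integral of `(1 + |z|)^(-(n + γ))`. -/
noncomputable def bracketConst (n : ℕ) (γ : ℝ) : ℝ :=
  (∫⁻ z : Fin n → ℝ, ENNReal.ofReal ((1 + ‖z‖) ^ (-((n : ℝ) + γ)))).toReal

theorem bracketConst_nonneg (n : ℕ) (γ : ℝ) : 0 ≤ bracketConst n γ := ENNReal.toReal_nonneg

theorem bracketKernel_nonneg {γ ρ : ℝ} (hρ : 0 < ρ) (z : Fin n → ℝ) :
    0 ≤ bracketKernel n γ ρ z := by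
  unfold bracketKernel; positivity

theorem measurable_bracketKernel (γ ρ : ℝ) : Measurable (bracketKernel n γ ρ) := by
  unfold bracketKernel
  fun_prop

/-- The kernel is the `L₁`-normalized dilate by `ρ` of `(1 + |z|)^{-(n+γ)}`, so its mass does not
depend on `ρ`. -/
theorem lintegral_bracketKernel {γ ρ : ℝ} (hγ : 0 < γ) (hρ : 0 < ρ) :
    ∫⁻ z, ENNReal.ofReal (bracketKernel n γ ρ z) = ENNReal.ofReal (bracketConst n γ) := by
  set G : (Fin n → ℝ) → ENNReal := fun z => ENNReal.ofReal ((1 + ‖z‖) ^ (-((n : ℝ) + γ))) with hG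
  have hGm : Measurable G := by fun_prop
  have hfin : ∫⁻ z, G z < ⊤ := by
    refine finite_integral_one_add_norm ?_
    rw [Module.finrank_fin_fun]
    linarith
  have h1 : ∀ z, ENNReal.ofReal (bracketKernel n γ ρ z) =
      ENNReal.ofReal ((ρ ^ n)⁻¹) * G (ρ⁻¹ • z) := by
    intro z
    rw [hG, ← ENNReal.ofReal_mul (by positivity)]
    congr 1
    have h2 : ρ + ‖z‖ = ρ * (1 + ‖ρ⁻¹ • z‖) := by
      rw [norm_smul, Real.norm_of_nonneg (by positivity)]
      field_simp
    rw [bracketKernel, h2, Real.mul_rpow hρ.le (by positivity), Real.rpow_neg (by positivity),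
      Real.rpow_add hρ, Real.rpow_natCast]
    have : ρ ^ γ ≠ 0 := by positivity
    field_simp
  simp_rw [h1]
  rw [lintegral_const_mul _ (show Measurable fun z => G (ρ⁻¹ • z) from
    hGm.comp (measurable_const_smul _)),
    ← lintegral_map hGm (measurable_const_smul _),
    Measure.map_addHaar_smul _ (inv_ne_zero hρ.ne'), lintegral_smul_measure, Module.finrank_fin_fun,
    smul_eq_mul, ← mul_assoc, ← ENNReal.ofReal_mul (by positivity), bracketConst,
    ENNReal.ofReal_toReal hfin.ne]
  rw [abs_of_pos (by positivity), inv_pow, inv_inv, inv_mul_cancel₀ (by positivity),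
    ENNReal.ofReal_one, one_mul]

/-- Schur's test for convolution with a nonnegative integrable kernel on `L₂`. -/
theorem lintegral_sq_convolution_le {W u : (Fin n → ℝ) → ENNReal} (hW : Measurable W)
    (hu : AEMeasurable u volume) :
    ∫⁻ x, (∫⁻ y, W (x - y) * u y) ^ 2 ≤ (∫⁻ z, W z) ^ 2 * ∫⁻ y, u y ^ 2 := by
  -- Cauchy–Schwarz for the product `1 · u` in the measure `W(x - y) dy`.
  have key : ∀ x, (∫⁻ y, W (x - y) * u y) ^ 2 ≤ (∫⁻ z, W z) * ∫⁻ y, W (x - y) * u y ^ 2 := by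
    intro x
    have hWx : Measurable (fun y => W (x - y)) := hW.comp (measurable_const.sub measurable_id)
    have h1 := ENNReal.lintegral_mul_le_Lp_mul_Lq (volume.withDensity fun y => W (x - y))
      (f := fun _ => 1) (g := u) Real.HolderConjugate.two_two aemeasurable_const
      (hu.mono_ac (withDensity_absolutelyContinuous _ _))
    have h2 : ∀ v : (Fin n → ℝ) → ENNReal, AEMeasurable v volume →
        ∫⁻ y, v y ∂(volume.withDensity fun y => W (x - y)) = ∫⁻ y, W (x - y) * v y := fun v hv => by
      rw [lintegral_withDensity_eq_lintegral_mul₀ hWx.aemeasurable hv]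
      rfl
    simp only [Pi.mul_apply, one_mul, ENNReal.rpow_two, one_pow] at h1
    rw [h2 _ hu, h2 _ aemeasurable_const, h2 _ (hu.pow_const 2)] at h1
    simp only [mul_one] at h1
    rw [lintegral_sub_left_eq_self W x] at h1
    calc _ ≤ ((∫⁻ z, W z) ^ ((1 : ℝ) / 2) * (∫⁻ y, W (x - y) * u y ^ 2) ^ ((1 : ℝ) / 2)) ^ 2 := by
          gcongr
      _ = _ := by
          rw [← ENNReal.mul_rpow_of_nonneg _ _ (by norm_num), ← ENNReal.rpow_natCast,
            ← ENNReal.rpow_mul]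
          norm_num
  calc ∫⁻ x, (∫⁻ y, W (x - y) * u y) ^ 2
      ≤ ∫⁻ x, (∫⁻ z, W z) * ∫⁻ y, W (x - y) * u y ^ 2 := lintegral_mono key
    _ = (∫⁻ z, W z) * ∫⁻ x, ∫⁻ y, W (x - y) * u y ^ 2 := by
        rw [lintegral_const_mul'']
        refine AEMeasurable.lintegral_prod_right' (f := fun p : (Fin n → ℝ) × (Fin n → ℝ) =>
          W (p.1 - p.2) * u p.2 ^ 2) ?_
        exact (hW.comp (measurable_fst.sub measurable_snd)).aemeasurable.mul
          ((hu.comp_quasiMeasurePreserving Measure.quasiMeasurePreserving_snd).pow_const 2)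
    _ = (∫⁻ z, W z) * ∫⁻ y, ∫⁻ x, W (x - y) * u y ^ 2 := by
        rw [lintegral_lintegral_swap]
        exact (hW.comp (measurable_fst.sub measurable_snd)).aemeasurable.mul
          ((hu.comp_quasiMeasurePreserving Measure.quasiMeasurePreserving_snd).pow_const 2)
    _ = (∫⁻ z, W z) * ∫⁻ y, (∫⁻ z, W z) * u y ^ 2 := by
        congr 1
        refine lintegral_congr fun y => ?_
        rw [lintegral_mul_const _ (show Measurable fun x => W (x - y) from
          hW.comp (measurable_id.sub_const y))]
        congr 1
        exact lintegral_sub_right_eq_self W y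
    _ = _ := by
        rw [lintegral_const_mul'' _ (hu.pow_const 2), ← mul_assoc, sq]

theorem eLpNorm_two_sq {α E : Type*} [MeasurableSpace α] [NormedAddCommGroup E] {μ : Measure α}
    (f : α → E) : eLpNorm f 2 μ ^ 2 = ∫⁻ x, ‖f x‖ₑ ^ 2 ∂μ := by
  have := eLpNorm_nnreal_pow_eq_lintegral (f := f) (μ := μ) (p := 2) two_ne_zero
  simpa using this

theorem eLpNorm_le_of_convolution_bound {W : (Fin n → ℝ) → ENNReal} (hW : Measurable W)
    {g h : (Fin n → ℝ) → ℂ} (hh : AEStronglyMeasurable h volume)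
    (hgh : ∀ᵐ x, ‖g x‖ₑ ≤ ∫⁻ y, W (x - y) * ‖h y‖ₑ) :
    eLpNorm g 2 volume ≤ (∫⁻ z, W z) * eLpNorm h 2 volume := by
  refine (ENNReal.pow_le_pow_left_iff (n := 2) two_ne_zero).1 ?_
  rw [mul_pow, eLpNorm_two_sq, eLpNorm_two_sq]
  refine (lintegral_mono_ae ?_).trans (lintegral_sq_convolution_le hW hh.enorm)
  filter_upwards [hgh] with x hx
  gcongr

end Kernels

/-! ### Truncated kernels -/

section Truncated

variable {n : ℕ}

/-- The kernel truncated to `|x - y| > ε`. -/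
noncomputable def truncKernel (K : (Fin n → ℝ) → (Fin n → ℝ) → ℂ) (ε : ℝ)
    (x y : Fin n → ℝ) : ℂ :=
  open Classical in if ε < dist x y then K x y else 0

/-- The convolution kernel that controls the increments of a truncated kernel. -/
noncomputable def shellKernel (n : ℕ) (γ δ ε : ℝ) (z : Fin n → ℝ) : ℝ :=
  2 ^ ((n : ℝ) + γ) * (δ / ε) ^ γ * bracketKernel n γ ε z +
    Set.indicator {z : Fin n → ℝ | |‖z‖ - ε| ≤ δ} (fun _ => 1 / ε ^ n) z

/-- The constant in the bound for the integral of `shellKernel`. -/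
noncomputable def shellConst (n : ℕ) (γ : ℝ) : ℝ :=
  2 ^ ((n : ℝ) + γ) * bracketConst n γ + n * 4 ^ n

theorem shellConst_nonneg (n : ℕ) (γ : ℝ) : 0 ≤ shellConst n γ := by
  have := bracketConst_nonneg n γ
  unfold shellConst; positivity

theorem shellKernel_neg (γ δ ε : ℝ) (z : Fin n → ℝ) :
    shellKernel n γ δ ε (-z) = shellKernel n γ δ ε z := by
  simp [shellKernel, bracketKernel, Set.indicator]

theorem measurableSet_shell (n : ℕ) (δ ε : ℝ) :
    MeasurableSet {z : Fin n → ℝ | |‖z‖ - ε| ≤ δ} :=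
  measurableSet_le (by fun_prop) (by fun_prop)

theorem measurable_shellKernel (γ δ ε : ℝ) : Measurable (shellKernel n γ δ ε) :=
  ((measurable_bracketKernel γ ε).const_mul _).add
    (measurable_const.indicator (measurableSet_shell n δ ε))

theorem volume_shell_le {δ ε : ℝ} (hδ : 0 < δ) (hδε : δ ≤ ε / 4) :
    volume {z : Fin n → ℝ | |‖z‖ - ε| ≤ δ} ≤ ENNReal.ofReal (n * 4 ^ n * (δ / ε) * ε ^ n) := by
  have hε : 0 < ε := by linarith
  have hsub : {z : Fin n → ℝ | |‖z‖ - ε| ≤ δ} ⊆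
      Metric.closedBall 0 (ε + δ) \ Metric.ball 0 (ε - δ) := by
    intro z hz
    rw [Set.mem_ofPred_eq, abs_le] at hz
    rw [Set.mem_sdiff, mem_closedBall_zero_iff, mem_ball_zero_iff]
    constructor <;> linarith
  refine (measure_mono hsub).trans ?_
  rw [measure_sdiff (Metric.ball_subset_closedBall.trans (Metric.closedBall_subset_closedBall
      (by linarith))) measurableSet_ball.nullMeasurableSet measure_ball_lt_top.ne,
    Real.volume_pi_closedBall _ (by linarith), Real.volume_pi_ball _ (by linarith),
    Fintype.card_fin, ← ENNReal.ofReal_sub _ (by have : 0 ≤ ε - δ := by linarith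
                                                 positivity)]
  refine ENNReal.ofReal_le_ofReal ?_
  refine (le_abs_self _).trans ((abs_pow_sub_pow_le _ _ _).trans ?_)
  rw [abs_of_nonneg (by linarith : 0 ≤ 2 * (ε + δ) - 2 * (ε - δ)),
    abs_of_nonneg (by linarith : 0 ≤ 2 * (ε + δ)), abs_of_nonneg (by linarith : 0 ≤ 2 * (ε - δ)),
    max_eq_left (by linarith)]
  rcases n with _ | n
  · simp
  calc (2 * (ε + δ) - 2 * (ε - δ)) * ((n + 1 : ℕ) : ℝ) * (2 * (ε + δ)) ^ n
      ≤ (4 * δ) * ((n + 1 : ℕ) : ℝ) * (4 * ε) ^ n := by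
        have h1 : 2 * (ε + δ) - 2 * (ε - δ) ≤ 4 * δ := by linarith
        have h2 : 2 * (ε + δ) ≤ 4 * ε := by linarith
        gcongr
    _ = _ := by field_simp; ring

/-- The smooth part has mass `~ (δ/ε)^γ` by scaling. The jump part has height `ε⁻ⁿ` on a shell of
volume `~ δ ε^{n-1}`, hence mass `~ δ/ε`, which is at most `(δ/ε)^γ` because `γ ≤ 1`. -/
theorem lintegral_shellKernel_le {γ δ ε : ℝ} (hγ0 : 0 < γ) (hγ1 : γ ≤ 1) (hδ : 0 < δ)
    (hδε : δ ≤ ε / 4) :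
    ∫⁻ z, ENNReal.ofReal (shellKernel n γ δ ε z) ≤
      ENNReal.ofReal (shellConst n γ * (δ / ε) ^ γ) := by
  have hε : 0 < ε := by linarith
  have hb := bracketConst_nonneg n γ
  have h1 : ∀ z, ENNReal.ofReal (shellKernel n γ δ ε z) =
      ENNReal.ofReal (2 ^ ((n : ℝ) + γ) * (δ / ε) ^ γ) * ENNReal.ofReal (bracketKernel n γ ε z) +
      Set.indicator {z : Fin n → ℝ | |‖z‖ - ε| ≤ δ} (fun _ => ENNReal.ofReal (1 / ε ^ n)) z := by
    intro z
    have h0 := bracketKernel_nonneg (n := n) (γ := γ) hε z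
    rw [shellKernel, ENNReal.ofReal_add (by positivity)
      (Set.indicator_nonneg (fun _ _ => by positivity) _), ENNReal.ofReal_mul (by positivity)]
    congr 1
    by_cases hz : z ∈ {z : Fin n → ℝ | |‖z‖ - ε| ≤ δ}
    · rw [Set.indicator_of_mem hz, Set.indicator_of_mem hz]
    · rw [Set.indicator_of_notMem hz, Set.indicator_of_notMem hz, ENNReal.ofReal_zero]
  simp_rw [h1]
  rw [lintegral_add_right _ (measurable_const.indicator (measurableSet_shell n δ ε)),
    lintegral_const_mul _ (measurable_bracketKernel γ ε).ennreal_ofReal,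
    lintegral_bracketKernel hγ0 hε, lintegral_indicator_const (measurableSet_shell n δ ε)]
  have h2 : δ / ε ≤ (δ / ε) ^ γ :=
    Real.self_le_rpow_of_le_one (by positivity) (by rw [div_le_one hε]; linarith) hγ1
  calc _ ≤ ENNReal.ofReal (2 ^ ((n : ℝ) + γ) * (δ / ε) ^ γ) * ENNReal.ofReal (bracketConst n γ) +
        ENNReal.ofReal (1 / ε ^ n) * ENNReal.ofReal (n * 4 ^ n * (δ / ε) * ε ^ n) := by
        gcongr
        exact volume_shell_le hδ hδε
    _ = ENNReal.ofReal (2 ^ ((n : ℝ) + γ) * (δ / ε) ^ γ * bracketConst n γ +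
        1 / ε ^ n * (n * 4 ^ n * (δ / ε) * ε ^ n)) := by
        rw [ENNReal.ofReal_add (by positivity) (by positivity),
          ENNReal.ofReal_mul (q := bracketConst n γ) (by positivity),
          ENNReal.ofReal_mul (p := 1 / ε ^ n) (by positivity)]
    _ ≤ _ := by
        refine ENNReal.ofReal_le_ofReal ?_
        rw [shellConst]
        have : 1 / ε ^ n * (n * 4 ^ n * (δ / ε) * ε ^ n) = n * 4 ^ n * (δ / ε) := by
          field_simp
        rw [this, add_mul]
        have h3 : (n : ℝ) * 4 ^ n * (δ / ε) ≤ n * 4 ^ n * (δ / ε) ^ γ := by gcongr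
        nlinarith

variable {K : (Fin n → ℝ) → (Fin n → ℝ) → ℂ} {A γ : ℝ}

theorem norm_truncKernel_le {ε : ℝ} (hA : 0 ≤ A) (hε : 0 < ε)
    (hsize : ∀ x y, x ≠ y → ‖K x y‖ ≤ A / dist x y ^ n) (x y : Fin n → ℝ) :
    ‖truncKernel K ε x y‖ ≤ A / ε ^ n := by
  unfold truncKernel
  split_ifs with h
  · refine (hsize x y (dist_pos.1 (hε.trans h))).trans ?_
    gcongr
  · rw [norm_zero]; positivity

/-- If both points survive the truncation, the smoothness of `K` applies, with `|x - y| ≥ (ε + |x -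
y|)/2`. If only one survives, `|x - y|` is within `δ` of `ε` and the size bound `A/εⁿ` is paid on
the shell. -/
theorem norm_truncKernel_sub_le {δ ε : ℝ} (hA : 0 ≤ A) (hγ0 : 0 < γ) (hδ : 0 < δ)
    (hδε : δ ≤ ε / 4)
    (hsize : ∀ x y, x ≠ y → ‖K x y‖ ≤ A / dist x y ^ n)
    (hsmooth : ∀ x y y', x ≠ y → dist y y' ≤ dist x y / 2 →
      ‖K x y - K x y'‖ ≤ A * dist y y' ^ γ / dist x y ^ ((n : ℝ) + γ))
    {x y y' : Fin n → ℝ} (hy : dist y y' ≤ δ) :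
    ‖truncKernel K ε x y - truncKernel K ε x y'‖ ≤ A * shellKernel n γ δ ε (x - y) := by
  have hε : 0 < ε := by linarith
  have hd : dist x y = ‖x - y‖ := dist_eq_norm _ _
  have h0 := bracketKernel_nonneg (n := n) (γ := γ) hε (x - y)
  have htri : |dist x y - dist x y'| ≤ δ := by
    rw [dist_comm x y, dist_comm x y']
    exact (abs_dist_sub_le y y' x).trans hy
  have hnear : (|dist x y - ε| ≤ δ) → A / ε ^ n ≤ A * shellKernel n γ δ ε (x - y) := by
    intro h
    rw [shellKernel, Set.indicator_of_mem (by rw [Set.mem_ofPred_eq, ← hd]; exact h), mul_add,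
      mul_one_div]
    have : 0 ≤ A * (2 ^ ((n : ℝ) + γ) * (δ / ε) ^ γ * bracketKernel n γ ε (x - y)) := by positivity
    linarith
  by_cases h1 : ε < dist x y
  · by_cases h2 : ε < dist x y'
    · simp only [truncKernel, if_pos h1, if_pos h2]
      refine (hsmooth x y y' (dist_pos.1 (hε.trans h1)) (by linarith)).trans ?_
      have h3 : 0 ≤ Set.indicator {z : Fin n → ℝ | |‖z‖ - ε| ≤ δ} (fun _ => 1 / ε ^ n) (x - y) :=
        Set.indicator_nonneg (fun _ _ => by positivity) _
      rw [mul_div_assoc]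
      refine mul_le_mul_of_nonneg_left ?_ hA
      refine le_trans ?_ (le_add_of_nonneg_right h3)
      rw [bracketKernel, Real.div_rpow hδ.le hε.le, ← hd]
      calc dist y y' ^ γ / dist x y ^ ((n : ℝ) + γ)
          ≤ δ ^ γ / ((ε + dist x y) / 2) ^ ((n : ℝ) + γ) := by
            gcongr
            linarith
        _ = _ := by
            rw [Real.div_rpow (by positivity) (by positivity)]
            field_simp
    · simp only [truncKernel, if_pos h1, if_neg h2, sub_zero]
      have := norm_truncKernel_le (ε := ε) hA hε hsize x y
      simp only [truncKernel, if_pos h1] at this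
      refine this.trans (hnear ?_)
      rw [abs_le] at htri ⊢
      constructor <;> linarith
  · by_cases h2 : ε < dist x y'
    · simp only [truncKernel, if_neg h1, if_pos h2, zero_sub, norm_neg]
      have := norm_truncKernel_le (ε := ε) hA hε hsize x y'
      simp only [truncKernel, if_pos h2] at this
      refine this.trans (hnear ?_)
      rw [abs_le] at htri ⊢
      constructor <;> linarith
    · simp only [truncKernel, if_neg h1, if_neg h2, sub_zero, norm_zero]
      have : 0 ≤ shellKernel n γ δ ε (x - y) := by
        unfold shellKernel
        have := Set.indicator_nonneg (s := {z : Fin n → ℝ | |‖z‖ - ε| ≤ δ})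
          (f := fun _ => 1 / ε ^ n) (fun _ _ => by positivity) (x - y)
        positivity
      positivity

theorem norm_truncKernel_le_of_dist_le {ε : ℝ} (hA : 0 ≤ A) (hε : 0 < ε)
    (hsize : ∀ x y, x ≠ y → ‖K x y‖ ≤ A / dist x y ^ n) {x y y' : Fin n → ℝ}
    (hy : dist y y' ≤ ε / 4) :
    ‖truncKernel K ε x y'‖ ≤ A * 4 ^ n / (ε + ‖x - y‖) ^ n := by
  rw [← dist_eq_norm]
  unfold truncKernel
  split_ifs with h
  · refine (hsize x y' (dist_pos.1 (hε.trans h))).trans ?_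
    have h1 : dist x y ≤ dist x y' + dist y y' := by
      rw [dist_comm y]; exact dist_triangle _ _ _
    calc A / dist x y' ^ n ≤ A / ((ε + dist x y) / 4) ^ n := by
          gcongr
          linarith
      _ = _ := by rw [div_pow]; field_simp
  · rw [norm_zero]; positivity

/-- The square of the bound is a multiple of the bracket kernel with exponent `γ = n`, integrable
since `n ≥ 1`. -/
theorem memLp_two_of_norm_le_div {ε M : ℝ} (hn : 1 ≤ n) (hε : 0 < ε)
    {φ : (Fin n → ℝ) → ℂ} (hφ : AEStronglyMeasurable φ volume) (x : Fin n → ℝ)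
    (h : ∀ y, ‖φ y‖ ≤ M / (ε + ‖x - y‖) ^ n) : MemLp φ 2 volume := by
  refine ⟨hφ, ?_⟩
  have hn0 : (0 : ℝ) < n := by exact_mod_cast hn
  have h1 : ∫⁻ y, ‖φ y‖ₑ ^ 2 < ⊤ := by
    calc ∫⁻ y, ‖φ y‖ₑ ^ 2
        ≤ ∫⁻ y, ENNReal.ofReal (M ^ 2 / ε ^ (n : ℝ)) *
            ENNReal.ofReal (bracketKernel n n ε (x - y)) := by
          refine lintegral_mono fun y => ?_
          rw [← ENNReal.ofReal_mul (by positivity), ← ofReal_norm,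
            ← ENNReal.ofReal_pow (norm_nonneg _)]
          refine ENNReal.ofReal_le_ofReal ?_
          refine (pow_le_pow_left₀ (norm_nonneg _) (h y) 2).trans (le_of_eq ?_)
          rw [bracketKernel, Real.rpow_add (by positivity), Real.rpow_natCast, Real.rpow_natCast]
          field_simp
      _ = ENNReal.ofReal (M ^ 2 / ε ^ (n : ℝ)) *
            ∫⁻ z, ENNReal.ofReal (bracketKernel n n ε z) := by
          have hm := (measurable_bracketKernel (n := n) n ε).ennreal_ofReal
          rw [lintegral_const_mul _ (show Measurable fun y =>
              ENNReal.ofReal (bracketKernel n n ε (x - y)) from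
              hm.comp (measurable_const.sub measurable_id)),
            lintegral_sub_left_eq_self (fun z => ENNReal.ofReal (bracketKernel n n ε z)) x]
      _ < ⊤ := by
          rw [lintegral_bracketKernel hn0 hε]
          exact ENNReal.mul_lt_top ENNReal.ofReal_lt_top ENNReal.ofReal_lt_top
  rw [← eLpNorm_two_sq] at h1
  exact lt_top_iff_ne_top.2 fun h2 => by simp [h2] at h1

end Truncated

/-! ### Truncated singular integrals of martingale differences -/

section TruncatedIntegral

variable {n : ℕ} {K : (Fin n → ℝ) → (Fin n → ℝ) → ℂ} {A γ : ℝ} {T : L2 n →L[ℂ] L2 n}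

/-- No measurability of `K` is assumed. The Hölder bounds in each variable give joint continuity off
the diagonal, from which measurability of the truncations follows. -/
theorem IsCalderonZygmund.continuousOn (hK : IsCalderonZygmund γ A K T) (hA : 0 ≤ A)
    (hγ : 0 < γ) :
    ContinuousOn (fun p : (Fin n → ℝ) × (Fin n → ℝ) => K p.1 p.2) {p | p.1 ≠ p.2} := by
  rintro ⟨x, y⟩ hxy
  have hxy' : x ≠ y := hxy
  have hd : 0 < dist x y := dist_pos.2 hxy'
  apply ContinuousAt.continuousWithinAt
  rw [ContinuousAt, tendsto_iff_norm_sub_tendsto_zero]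
  set b : (Fin n → ℝ) × (Fin n → ℝ) → ℝ := fun p =>
    A * dist y p.2 ^ γ / (dist x y / 2) ^ ((n : ℝ) + γ) +
      A * dist x p.1 ^ γ / dist x y ^ ((n : ℝ) + γ) with hb
  have hbc : Tendsto b (𝓝 (x, y)) (𝓝 0) := by
    have h1 : Tendsto (fun p : (Fin n → ℝ) × (Fin n → ℝ) => dist y p.2 ^ γ) (𝓝 (x, y)) (𝓝 0) := by
      have : Continuous (fun p : (Fin n → ℝ) × (Fin n → ℝ) => dist y p.2 ^ γ) :=
        (continuous_const.dist continuous_snd).rpow_const fun _ => Or.inr hγ.le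
      simpa [Real.zero_rpow hγ.ne'] using this.tendsto (x, y)
    have h2 : Tendsto (fun p : (Fin n → ℝ) × (Fin n → ℝ) => dist x p.1 ^ γ) (𝓝 (x, y)) (𝓝 0) := by
      have : Continuous (fun p : (Fin n → ℝ) × (Fin n → ℝ) => dist x p.1 ^ γ) :=
        (continuous_const.dist continuous_fst).rpow_const fun _ => Or.inr hγ.le
      simpa [Real.zero_rpow hγ.ne'] using this.tendsto (x, y)
    simpa [hb] using ((h1.const_mul A).div_const _).add ((h2.const_mul A).div_const _)
  refine squeeze_zero' (Eventually.of_forall fun _ => norm_nonneg _) ?_ hbc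
  filter_upwards [Metric.ball_mem_nhds (x, y) (show 0 < dist x y / 4 by positivity)] with p hp
  obtain ⟨x', y'⟩ := p
  rw [Metric.mem_ball, Prod.dist_eq, max_lt_iff] at hp
  obtain ⟨hx', hy'⟩ := hp
  simp only at hx' hy'
  rw [dist_comm] at hx' hy'
  have h3 : dist x y / 2 ≤ dist x' y := by
    have := dist_triangle x x' y
    linarith
  have h4 : ‖K x' y' - K x' y‖ ≤ A * dist y y' ^ γ / (dist x y / 2) ^ ((n : ℝ) + γ) := by
    rw [norm_sub_rev]
    refine (hK.smooth_right x' y y' (dist_pos.1 (by linarith)) (by linarith)).trans ?_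
    gcongr
  have h5 : ‖K x' y - K x y‖ ≤ A * dist x x' ^ γ / dist x y ^ ((n : ℝ) + γ) := by
    rw [norm_sub_rev]
    exact hK.smooth_left x x' y hxy' (by linarith)
  calc ‖K x' y' - K x y‖ = ‖(K x' y' - K x' y) + (K x' y - K x y)‖ := by congr 1; ring
    _ ≤ _ := (norm_add_le _ _).trans (add_le_add h4 h5)

theorem IsCalderonZygmund.measurable_truncKernel (hK : IsCalderonZygmund γ A K T) (hA : 0 ≤ A)
    (hγ : 0 < γ) {ε : ℝ} (hε : 0 < ε) :
    Measurable (fun p : (Fin n → ℝ) × (Fin n → ℝ) => truncKernel K ε p.1 p.2) := by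
  classical
  have h1 : ContinuousOn (fun p : (Fin n → ℝ) × (Fin n → ℝ) => K p.1 p.2)
      {p | ε < dist p.1 p.2} :=
    (hK.continuousOn hA hγ).mono fun p hp => dist_pos.1 (hε.trans hp)
  have h2 : MeasurableSet {p : (Fin n → ℝ) × (Fin n → ℝ) | ε < dist p.1 p.2} :=
    measurableSet_lt measurable_const (measurable_fst.dist measurable_snd)
  have h3 := ContinuousOn.measurable_piecewise h1
    (continuousOn_const (c := (0 : ℂ))) h2
  convert h3 using 1
  ext p
  simp [truncKernel, Set.piecewise]

theorem IsCalderonZygmund.memLp_truncKernel (hK : IsCalderonZygmund γ A K T) (hA : 0 ≤ A)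
    (hn : 1 ≤ n) (hγ : 0 < γ) {ε : ℝ} (hε : 0 < ε) (x : Fin n → ℝ) :
    MemLp (truncKernel K ε x) 2 volume :=
  memLp_two_of_norm_le_div (M := A * 4 ^ n) hn hε
    ((hK.measurable_truncKernel hA hγ hε).comp measurable_prodMk_left).aestronglyMeasurable x
    fun y => norm_truncKernel_le_of_dist_le hA hε hK.size (by rw [dist_self]; positivity)

theorem IsCalderonZygmund.integrable_truncKernel_mul (hK : IsCalderonZygmund γ A K T) (hA : 0 ≤ A)
    (hn : 1 ≤ n) (hγ : 0 < γ) {ε : ℝ} (hε : 0 < ε) (h : L2 n) (x : Fin n → ℝ) :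
    Integrable (fun y => truncKernel K ε x y * h y) volume :=
  (hK.memLp_truncKernel hA hn hγ hε x).integrable_mul (Lp.memLp h)

/-- The truncated singular integral `∫_{|x-y|>ε} K(x,y) h(y) dy`. -/
noncomputable def truncIntegral (K : (Fin n → ℝ) → (Fin n → ℝ) → ℂ) (ε : ℝ) (h : L2 n)
    (x : Fin n → ℝ) : ℂ :=
  ∫ y, truncKernel K ε x y * h y

theorem IsCalderonZygmund.stronglyMeasurable_truncIntegral (hK : IsCalderonZygmund γ A K T)
    (hA : 0 ≤ A) (hγ : 0 < γ) {ε : ℝ} (hε : 0 < ε) (h : L2 n) :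
    StronglyMeasurable (truncIntegral K ε h) :=
  StronglyMeasurable.integral_prod_right'
    (f := fun p : (Fin n → ℝ) × (Fin n → ℝ) => truncKernel K ε p.1 p.2 * h p.2)
    ((hK.measurable_truncKernel hA hγ hε).stronglyMeasurable.mul
      ((Lp.stronglyMeasurable h).comp_measurable measurable_snd))

theorem lintegral_shellKernel_mul_le {δ ε : ℝ} (hA : 0 ≤ A) (hγ0 : 0 < γ) (hγ1 : γ ≤ 1)
    (hδ : 0 < δ) (hδε : δ ≤ ε / 4) :
    ∫⁻ z, ENNReal.ofReal (A * shellKernel n γ δ ε z) ≤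
      ENNReal.ofReal (A * (shellConst n γ * (δ / ε) ^ γ)) := by
  simp_rw [ENNReal.ofReal_mul hA]
  rw [lintegral_const_mul _ (measurable_shellKernel γ δ ε).ennreal_ofReal]
  gcongr
  exact lintegral_shellKernel_le hγ0 hγ1 hδ hδε

/-- Since `h` is orthogonal to functions constant on cubes of level `j`, the kernel sampled at the
corner of the cube of `y` can be subtracted; what remains is an increment in `y`. -/
theorem IsCalderonZygmund.eLpNorm_truncIntegral_le (hK : IsCalderonZygmund γ A K T) (hA : 0 ≤ A)
    (hn : 1 ≤ n) (hγ0 : 0 < γ) (hγ1 : γ ≤ 1) {ε : ℝ} {j : ℤ} (hj : (2 : ℝ) ^ (-j) ≤ ε / 4)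
    {h : L2 n} (hh : dyadicExp n j h = 0) :
    eLpNorm (truncIntegral K ε h) 2 volume ≤
      ENNReal.ofReal (A * (shellConst n γ * ((2 : ℝ) ^ (-j) / ε) ^ γ)) * eLpNorm h 2 volume := by
  have hδ : (0 : ℝ) < 2 ^ (-j) := by positivity
  have hε : 0 < ε := by linarith
  refine (eLpNorm_le_of_convolution_bound
    (W := fun z => ENNReal.ofReal (A * shellKernel n γ (2 ^ (-j)) ε z))
    ((measurable_shellKernel γ _ ε).const_mul A).ennreal_ofReal
    (Lp.aestronglyMeasurable h) (Eventually.of_forall fun x => ?_)).trans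
    (mul_le_mul_left (lintegral_shellKernel_mul_le hA hγ0 hγ1 hδ hj) _)
  have hm : StronglyMeasurable[dyadicSigma n j] (fun y => truncKernel K ε x (dyadicCorner j y)) :=
    stronglyMeasurable_comp_dyadicIndex j (fun m => truncKernel K ε x (dyadicPoint j m))
  have hL : MemLp (fun y => truncKernel K ε x (dyadicCorner j y)) 2 volume :=
    memLp_two_of_norm_le_div (M := A * 4 ^ n) hn hε
      (hm.mono (dyadicSigma_le n j)).aestronglyMeasurable x fun y =>
      norm_truncKernel_le_of_dist_le hA hε hK.size ((dist_dyadicCorner j y).trans hj)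
  have h0 := integral_mul_eq_zero_of_dyadicExp_eq_zero hm hL hh
  have h1 : truncIntegral K ε h x =
      ∫ y, (truncKernel K ε x y - truncKernel K ε x (dyadicCorner j y)) * h y := by
    simp_rw [sub_mul]
    rw [integral_sub (hK.integrable_truncKernel_mul hA hn hγ0 hε h x)
      (show Integrable (fun y => truncKernel K ε x (dyadicCorner j y) * h y) volume from
        hL.integrable_mul (Lp.memLp h)), h0, sub_zero, truncIntegral]
  rw [h1]
  refine (enorm_integral_le_lintegral_enorm _).trans (lintegral_mono fun y => ?_)
  rw [enorm_mul]
  gcongr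
  rw [← ofReal_norm]
  exact ENNReal.ofReal_le_ofReal
    (norm_truncKernel_sub_le hA hγ0 hδ hj hK.size hK.smooth_right (dist_dyadicCorner j y))

/-- The counterpart in `x`: no cancellation of `h` is used, only regularity of the kernel in its
first variable. -/
theorem IsCalderonZygmund.eLpNorm_truncIntegral_sub_corner_le (hK : IsCalderonZygmund γ A K T)
    (hA : 0 ≤ A) (hn : 1 ≤ n) (hγ0 : 0 < γ) (hγ1 : γ ≤ 1) {ε : ℝ} {j : ℤ}
    (hj : (2 : ℝ) ^ (-j) ≤ ε / 4) (h : L2 n) :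
    eLpNorm (fun x => truncIntegral K ε h x - truncIntegral K ε h (dyadicCorner j x)) 2 volume ≤
      ENNReal.ofReal (A * (shellConst n γ * ((2 : ℝ) ^ (-j) / ε) ^ γ)) * eLpNorm h 2 volume := by
  have hδ : (0 : ℝ) < 2 ^ (-j) := by positivity
  have hε : 0 < ε := by linarith
  refine (eLpNorm_le_of_convolution_bound
    (W := fun z => ENNReal.ofReal (A * shellKernel n γ (2 ^ (-j)) ε z))
    ((measurable_shellKernel γ _ ε).const_mul A).ennreal_ofReal
    (Lp.aestronglyMeasurable h) (Eventually.of_forall fun x => ?_)).trans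
    (mul_le_mul_left (lintegral_shellKernel_mul_le hA hγ0 hγ1 hδ hj) _)
  rw [truncIntegral, truncIntegral, ← integral_sub (hK.integrable_truncKernel_mul hA hn hγ0 hε h x)
    (hK.integrable_truncKernel_mul hA hn hγ0 hε h _)]
  refine (enorm_integral_le_lintegral_enorm _).trans (lintegral_mono fun y => ?_)
  rw [← sub_mul, enorm_mul]
  gcongr
  rw [← ofReal_norm]
  refine ENNReal.ofReal_le_ofReal ?_
  have hsymm : ∀ x y, truncKernel K ε x y = truncKernel (fun x y => K y x) ε y x := fun x y => by
    simp only [truncKernel, dist_comm]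
  rw [hsymm, hsymm, ← shellKernel_neg, neg_sub]
  refine norm_truncKernel_sub_le hA hγ0 hδ hj (fun x y hxy => ?_) (fun x y y' hxy hy => ?_)
    (dist_dyadicCorner j x)
  · rw [dist_comm]; exact hK.size y x hxy.symm
  · rw [dist_comm x y] at hy ⊢
    exact hK.smooth_left y y' x hxy.symm hy

theorem Lp_norm_le_of_eLpNorm_le {f g : L2 n} {f' : (Fin n → ℝ) → ℂ} (hf : f =ᵐ[volume] f') {c : ℝ}
    (hc : 0 ≤ c) (h : eLpNorm f' 2 volume ≤ ENNReal.ofReal c * eLpNorm g 2 volume) :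
    ‖f‖ ≤ c * ‖g‖ := by
  rw [Lp.norm_def, Lp.norm_def, eLpNorm_congr_ae hf, ← ENNReal.toReal_ofReal hc,
    ← ENNReal.toReal_mul]
  exact ENNReal.toReal_mono (ENNReal.mul_ne_top ENNReal.ofReal_ne_top (Lp.eLpNorm_ne_top g)) h

/-- The operator `T_ε Δ_m`. -/
theorem IsCalderonZygmund.exists_truncated_dyadicDiff (hK : IsCalderonZygmund γ A K T)
    (hA : 0 ≤ A) (hn : 1 ≤ n) (hγ0 : 0 < γ) (hγ1 : γ ≤ 1) {ε : ℝ} {m : ℤ}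
    (hm : (2 : ℝ) ^ (-(m - 1)) ≤ ε / 4) :
    ∃ G : L2 n →L[ℂ] L2 n,
      (∀ f, IsTruncatedIntegral K ε (dyadicDiff n m f) (G f)) ∧
      (∀ f, ‖G f‖ ≤ A * (shellConst n γ * ((2 : ℝ) ^ (-(m - 1)) / ε) ^ γ) * ‖dyadicDiff n m f‖) ∧
      ∀ j : ℤ, (2 : ℝ) ^ (-j) ≤ ε / 4 → ∀ f, ‖G f - dyadicExp n j (G f)‖ ≤
        A * (shellConst n γ * ((2 : ℝ) ^ (-j) / ε) ^ γ) * ‖dyadicDiff n m f‖ := by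
  have hδ : (0 : ℝ) < 2 ^ (-(m - 1)) := by positivity
  have hε : 0 < ε := by linarith
  have hC := shellConst_nonneg n γ
  -- `Δ_m f` has mean zero on cubes of level `m - 1`, one level coarser than its own; hence the `m -
  -- 1` in the bounds.
  have hh : ∀ f, dyadicExp n (m - 1) (dyadicDiff n m f) = 0 := fun f =>
    dyadicExp_dyadicDiff_of_lt (by omega) f
  have hint := hK.integrable_truncKernel_mul hA hn hγ0 hε
  have hb := fun f => hK.eLpNorm_truncIntegral_le hA hn hγ0 hγ1 hm (hh f)
  have hL : ∀ f, MemLp (truncIntegral K ε (dyadicDiff n m f)) 2 volume := fun f =>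
    ⟨(hK.stronglyMeasurable_truncIntegral hA hγ0 hε _).aestronglyMeasurable,
      (hb f).trans_lt (ENNReal.mul_lt_top ENNReal.ofReal_lt_top (Lp.eLpNorm_lt_top _))⟩
  have hadd : ∀ f g : L2 n, truncIntegral K ε (f + g) =
      truncIntegral K ε f + truncIntegral K ε g := by
    intro f g
    ext x
    simp only [truncIntegral, Pi.add_apply]
    rw [← integral_add (hint f x) (hint g x)]
    refine integral_congr_ae ?_
    filter_upwards [Lp.coeFn_add f g] with y hy
    rw [hy, Pi.add_apply, mul_add]
  have hsmul : ∀ (c : ℂ) (f : L2 n), truncIntegral K ε (c • f) = c • truncIntegral K ε f := by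
    intro c f
    ext x
    simp only [truncIntegral, Pi.smul_apply, smul_eq_mul]
    rw [← integral_const_mul]
    refine integral_congr_ae ?_
    filter_upwards [Lp.coeFn_smul c f] with y hy
    rw [hy, Pi.smul_apply, smul_eq_mul]
    ring
  let G₀ : L2 n →ₗ[ℂ] L2 n :=
    { toFun := fun f => (hL f).toLp
      map_add' := fun f g => by
        rw [← MemLp.toLp_add]
        exact MemLp.toLp_congr _ _ (by rw [map_add, hadd])
      map_smul' := fun c f => by
        rw [RingHom.id_apply, ← MemLp.toLp_const_smul]
        exact MemLp.toLp_congr _ _ (by rw [map_smul, hsmul]) }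
  have hG₀ : ∀ f, G₀ f =ᵐ[volume] truncIntegral K ε (dyadicDiff n m f) := fun f =>
    (hL f).coeFn_toLp
  have hbound : ∀ f, ‖G₀ f‖ ≤
      A * (shellConst n γ * ((2 : ℝ) ^ (-(m - 1)) / ε) ^ γ) * ‖dyadicDiff n m f‖ := fun f =>
    Lp_norm_le_of_eLpNorm_le (hG₀ f) (by positivity) (hb f)
  refine ⟨G₀.mkContinuous
    (A * (shellConst n γ * ((2 : ℝ) ^ (-(m - 1)) / ε) ^ γ) * ‖dyadicDiff n m‖) fun f => ?_,
    fun f => ?_, hbound, fun j hj f => ?_⟩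
  · refine (hbound f).trans ?_
    rw [mul_assoc _ ‖dyadicDiff n m‖]
    gcongr
    exact (dyadicDiff n m).le_opNorm f
  · have hset : ∀ x, MeasurableSet {y : Fin n → ℝ | ε < dist x y} := fun x =>
      measurableSet_lt measurable_const (measurable_const.dist measurable_id)
    have hind : ∀ x, (fun y => truncKernel K ε x y * dyadicDiff n m f y) =
        Set.indicator {y | ε < dist x y} (fun y => K x y * dyadicDiff n m f y) := by
      intro x
      ext y
      by_cases hy : ε < dist x y <;> simp [truncKernel, Set.indicator, hy]
    refine ⟨fun x => ?_, ?_⟩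
    · rw [← integrable_indicator_iff (hset x), ← hind]
      exact hint _ x
    · filter_upwards [hG₀ f] with x hx
      rw [← integral_indicator (hset x), ← hind]
      exact hx
  · have hcL : MemLp (fun x => truncIntegral K ε (dyadicDiff n m f) x -
        truncIntegral K ε (dyadicDiff n m f) (dyadicCorner j x)) 2 volume := by
      refine ⟨((hK.stronglyMeasurable_truncIntegral hA hγ0 hε _).sub
        (StronglyMeasurable.mono (stronglyMeasurable_comp_dyadicIndex j
          (fun l => truncIntegral K ε (dyadicDiff n m f) (dyadicPoint j l)))
          (dyadicSigma_le n j))).aestronglyMeasurable, ?_⟩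
      exact (hK.eLpNorm_truncIntegral_sub_corner_le hA hn hγ0 hγ1 hj _).trans_lt
        (ENNReal.mul_lt_top ENNReal.ofReal_lt_top (Lp.eLpNorm_lt_top _))
    -- The competitor is the truncated integral sampled at corners, a step function of level `j`.
    have ha : AEStronglyMeasurable[dyadicSigma n j]
        (G₀ f - hcL.toLp _ : L2 n) (volume : Measure (Fin n → ℝ)) := by
      refine ⟨_, stronglyMeasurable_comp_dyadicIndex j
        (fun l => truncIntegral K ε (dyadicDiff n m f) (dyadicPoint j l)), ?_⟩
      filter_upwards [Lp.coeFn_sub (G₀ f) (hcL.toLp _), hG₀ f, hcL.coeFn_toLp] with x h1 h2 h3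
      rw [h1, Pi.sub_apply, h2, h3, sub_sub_cancel]
      rfl
    refine (norm_sub_dyadicExp_le_norm_sub _ ha).trans ?_
    have : G₀ f - (G₀ f - hcL.toLp _) = hcL.toLp _ := by abel
    rw [LinearMap.mkContinuous_apply, this]
    exact Lp_norm_le_of_eLpNorm_le hcL.coeFn_toLp (by positivity)
      (hK.eLpNorm_truncIntegral_sub_corner_le hA hn hγ0 hγ1 hj _)

end TruncatedIntegral

/-! ### ### Almost orthogonality for truncated singular integrals -/

section Pseudolocalization

variable {n : ℕ} {K : (Fin n → ℝ) → (Fin n → ℝ) → ℂ} {A γ : ℝ} {T : L2 n →L[ℂ] L2 n}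

theorem two_rpow_neg_mem_Ioo {γ : ℝ} (hγ : 0 < γ) :
    0 < (2 : ℝ) ^ (-γ) ∧ (2 : ℝ) ^ (-γ) < 1 :=
  ⟨by positivity, Real.rpow_lt_one_of_one_lt_of_neg one_lt_two (by linarith)⟩

theorem two_zpow_neg_rpow (γ : ℝ) (d : ℕ) :
    ((2 : ℝ) ^ (-(d : ℤ))) ^ γ = ((2 : ℝ) ^ (-γ)) ^ d := by
  rw [← Real.rpow_intCast, ← Real.rpow_natCast, ← Real.rpow_mul two_pos.le,
    ← Real.rpow_mul two_pos.le]
  congr 1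
  push_cast
  ring

/-- The range of the projection `id - E_j` lies in that of `id - E_i`. So the term of coarser scale
is tested at the finer level `j`, where it is nearly constant on cubes. -/
theorem inner_sub_dyadicExp_sub_dyadicExp {i j : ℤ} (hij : i ≤ j) (f g : L2 n) :
    inner ℂ (f - dyadicExp n i f) (g - dyadicExp n j g) =
      inner ℂ (f - dyadicExp n j f) (g - dyadicExp n j g) := by
  simp only [inner_sub_left, inner_sub_right, inner_dyadicExp_left]
  rw [dyadicExp_dyadicExp_of_ge hij, dyadicExp_dyadicExp_of_le le_rfl]
  ring

/-- Pseudolocalization for truncated singular integrals. -/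
theorem IsCalderonZygmund.exists_hasSum_truncated (hK : IsCalderonZygmund γ A K T)
    (hA : 0 ≤ A) (hn : 1 ≤ n) (hγ0 : 0 < γ) (hγ1 : γ ≤ 1) {s : ℕ} (hs : 1 ≤ s) :
    ∃ Ψ : L2 n →L[ℂ] L2 n,
      (∀ f : L2 n, ∃ g : ℤ → L2 n,
        (∀ k : ℤ, IsTruncatedIntegral K (4 * (2 : ℝ) ^ (-k))
          (dyadicDiff n (k + s) f) (g k)) ∧
        HasSum (fun k : ℤ => g k - dyadicExp n k (g k)) (Ψ f)) ∧
      ‖Ψ‖ ≤ √(2 / (1 - 2 ^ (-γ))) * shellConst n γ * A * (2 : ℝ) ^ (-(γ * s / 2)) := by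
  have hC := shellConst_nonneg n γ
  obtain ⟨hr0, hr1⟩ := two_rpow_neg_mem_Ioo hγ0
  have hr1' : 0 < 1 - (2 : ℝ) ^ (-γ) := by linarith
  have hscale : ∀ k l : ℤ, k ≤ l → (2 : ℝ) ^ (-l) ≤ 4 * (2 : ℝ) ^ (-k) / 4 := by
    intro k l hkl
    rw [mul_div_cancel_left₀ _ (four_ne_zero)]
    exact zpow_le_zpow_right₀ one_le_two (by omega)
  have hratio : ∀ (k l : ℤ) (d : ℕ), l = k + d →
      ((2 : ℝ) ^ (-l) / (4 * (2 : ℝ) ^ (-k))) ^ γ ≤ ((2 : ℝ) ^ (-γ)) ^ d := by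
    rintro k l d rfl
    rw [← two_zpow_neg_rpow]
    refine Real.rpow_le_rpow (by positivity) ?_ hγ0.le
    have h2 : (0 : ℝ) < 2 ^ (-k) := by positivity
    rw [neg_add, zpow_add₀ two_ne_zero, div_le_iff₀ (by positivity)]
    have h3 : (0 : ℝ) < 2 ^ (-(d : ℤ)) := by positivity
    nlinarith [mul_pos h2 h3]
  have hratio' : ∀ k : ℤ, ((2 : ℝ) ^ (-(k + s - 1)) / (4 * (2 : ℝ) ^ (-k))) ^ γ ≤
      ((2 : ℝ) ^ (-γ)) ^ s := by
    intro k
    rw [← two_zpow_neg_rpow]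
    refine Real.rpow_le_rpow (by positivity) ?_ hγ0.le
    have h2 : (0 : ℝ) < 2 ^ (-k) := by positivity
    have h3 : (0 : ℝ) < 2 ^ (-(s : ℤ)) := by positivity
    rw [show -(k + (s : ℤ) - 1) = -k + -(s : ℤ) + 1 by ring, zpow_add₀ two_ne_zero,
      zpow_add₀ two_ne_zero, zpow_one, div_le_iff₀ (by positivity)]
    nlinarith [mul_pos h2 h3]
  -- The requirement is `2^{-(k+s-1)} ≤ ε/4 = 2⁻ᵏ`, that is, `s ≥ 1`.
  choose G hG1 hG2 hG3 using fun k : ℤ => hK.exists_truncated_dyadicDiff hA hn hγ0 hγ1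
    (hscale k (k + s - 1) (by omega))
  -- Only one of the two factors of an inner product is spent on decay in `s`, hence a single power
  -- `2^{-γs}`; the other supplies `r^|i-j|`.
  set B : ℝ := (A * shellConst n γ) ^ 2 * ((2 : ℝ) ^ (-γ)) ^ s with hB
  have hM : 2 * B / (1 - (2 : ℝ) ^ (-γ)) ≤
      (√(2 / (1 - 2 ^ (-γ))) * shellConst n γ * A * (2 : ℝ) ^ (-(γ * s / 2))) ^ 2 := by
    have e1 : ((2 : ℝ) ^ (-(γ * s / 2))) ^ 2 = ((2 : ℝ) ^ (-γ)) ^ s := by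
      rw [← Real.rpow_natCast, ← Real.rpow_natCast, ← Real.rpow_mul two_pos.le,
        ← Real.rpow_mul two_pos.le]
      congr 1
      push_cast
      ring
    rw [mul_pow, mul_pow, mul_pow, Real.sq_sqrt (by positivity), e1, hB]
    apply le_of_eq
    ring
  obtain ⟨Ψ, hΨ, hΨn⟩ := exists_hasSum_of_almostOrthogonal
    (Λ := fun k => G k - (dyadicExp n k).comp (G k)) (D := fun k => dyadicDiff n (k + s))
    (B := B) (r := (2 : ℝ) ^ (-γ)) (by positivity) hr0.le hr1 (by positivity) hM
    (fun S f => by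
      have := sum_norm_sq_dyadicDiff_le (S.map (addRightEmbedding (s : ℤ))) f
      rw [Finset.sum_map] at this
      exact this)
    (fun i j hij f => by
      obtain ⟨d, rfl⟩ := Int.le.dest hij
      have e : (i - (i + (d : ℤ))).natAbs = d := by omega
      rw [e]
      change ‖inner ℂ (G i f - dyadicExp n i (G i f))
        (G (i + d) f - dyadicExp n (i + d) (G (i + d) f))‖ ≤ _
      rw [inner_sub_dyadicExp_sub_dyadicExp hij]
      have h1 : ‖G i f - dyadicExp n (i + d) (G i f)‖ ≤
          A * (shellConst n γ * ((2 : ℝ) ^ (-γ)) ^ d) * ‖dyadicDiff n (i + s) f‖ := by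
        refine (hG3 i (i + d) (hscale _ _ hij) f).trans ?_
        gcongr
        exact hratio _ _ _ rfl
      have h2 : ‖G (i + d) f - dyadicExp n (i + d) (G (i + d) f)‖ ≤
          A * (shellConst n γ * ((2 : ℝ) ^ (-γ)) ^ s) * ‖dyadicDiff n (i + d + s) f‖ := by
        refine (norm_sub_dyadicExp_le_norm_sub _ (a := 0) ?_).trans ?_
        · exact (aestronglyMeasurable_zero).congr (Lp.coeFn_zero _ _ _).symm
        · rw [sub_zero]
          refine (hG2 (i + d) f).trans ?_
          gcongr
          exact hratio' _
      refine (norm_inner_le_norm _ _).trans ((mul_le_mul h1 h2 (norm_nonneg _)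
        (by positivity)).trans (le_of_eq ?_))
      rw [hB]
      ring)
  exact ⟨Ψ, fun f => ⟨fun k => G k f, fun k => hG1 k f, hΨ f⟩, hΨn⟩

end Pseudolocalization

/-! ### Translates of dyadic step functions -/

section StepFunctions

variable {n : ℕ}

/-- The points that translation by `z` moves out of their dyadic cube. -/
def dyadicExit (k : ℤ) (z : Fin n → ℝ) : Set (Fin n → ℝ) :=
  {x | dyadicIndex k (x + z) ≠ dyadicIndex k x}

theorem measurable_dyadicIndex' (k : ℤ) :
    @Measurable _ _ MeasurableSpace.pi ⊤ (dyadicIndex (n := n) k) :=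
  (measurable_dyadicIndex k).mono (dyadicSigma_le n k) le_rfl

theorem measurableSet_dyadicExit (k : ℤ) (z : Fin n → ℝ) : MeasurableSet (dyadicExit k z) := by
  let _ : MeasurableSpace (Fin n → ℤ) := ⊤
  have : DiscreteMeasurableSpace (Fin n → ℤ) := ⟨fun _ => trivial⟩
  have h1 : Measurable (dyadicIndex (n := n) k) := measurable_dyadicIndex' k
  exact (measurableSet_eq_fun (h1.comp (measurable_id.add_const z)) h1).compl

/-- A point that leaves its cube crosses a face in some coordinate `i`, on the side given by the
sign of `z i`. It lies in one of `n` slabs of thickness `‖z‖`. -/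
theorem volume_dyadicExit_inter_le (k : ℤ) (z : Fin n → ℝ) (m : Fin n → ℤ) :
    volume (dyadicExit k z ∩ dyadicCube k m) ≤
      ENNReal.ofReal (min 1 (n * ‖z‖ / 2 ^ (-k))) * volume (dyadicCube k m) := by
  set l : ℝ := 2 ^ (-k) with hl
  have hl0 : 0 < l := by positivity
  rcases le_total 1 (n * ‖z‖ / l) with h | h
  · rw [min_eq_left h, ENNReal.ofReal_one, one_mul]
    exact measure_mono Set.inter_subset_right
  rw [min_eq_right h]
  have hcov : dyadicExit k z ∩ dyadicCube k m ⊆ ⋃ i : Fin n, Set.univ.pi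
      (Function.update (fun i => Set.Ico ((m i : ℝ) * l) (((m i : ℝ) + 1) * l)) i
        (if 0 ≤ z i then Set.Ico (((m i : ℝ) + 1) * l - ‖z‖) (((m i : ℝ) + 1) * l)
          else Set.Ico ((m i : ℝ) * l) ((m i : ℝ) * l + ‖z‖))) := by
    rintro x ⟨hx1, hx2⟩
    rw [dyadicExit, Set.mem_ofPred_eq, mem_dyadicCube_iff.1 hx2, Ne, ← mem_dyadicCube_iff,
      dyadicCube, Set.mem_univ_pi] at hx1
    rw [dyadicCube, Set.mem_univ_pi] at hx2
    push Not at hx1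
    obtain ⟨i, hi⟩ := hx1
    refine Set.mem_iUnion.2 ⟨i, Set.mem_univ_pi.2 fun j => ?_⟩
    rcases eq_or_ne j i with rfl | hj
    · rw [Function.update_self]
      have h1 := hx2 j
      have h2 : |z j| ≤ ‖z‖ := norm_le_pi_norm z j
      rw [Set.mem_Ico, Pi.add_apply, not_and_or, not_le, not_lt] at hi
      rw [Set.mem_Ico] at h1
      rw [abs_le] at h2
      split_ifs with hz
      · rw [Set.mem_Ico]
        rcases hi with hi | hi <;> constructor <;> linarith
      · rw [Set.mem_Ico]
        rcases hi with hi | hi <;> constructor <;> linarith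
    · rw [Function.update_of_ne hj]
      exact hx2 j
  refine (measure_mono hcov).trans ((measure_iUnion_le _).trans ?_)
  rcases n with _ | n
  · simp
  have hslab : ∀ i : Fin (n + 1), volume (Set.univ.pi
      (Function.update (fun i => Set.Ico ((m i : ℝ) * l) (((m i : ℝ) + 1) * l)) i
        (if 0 ≤ z i then Set.Ico (((m i : ℝ) + 1) * l - ‖z‖) (((m i : ℝ) + 1) * l)
          else Set.Ico ((m i : ℝ) * l) ((m i : ℝ) * l + ‖z‖)))) =
      ENNReal.ofReal ‖z‖ * ENNReal.ofReal l ^ n := by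
    intro i
    rw [volume_pi_pi, ← Finset.mul_prod_erase _ _ (Finset.mem_univ i), Function.update_self]
    congr 1
    · split_ifs <;> rw [Real.volume_Ico] <;> congr 1 <;> ring
    · rw [Finset.prod_congr rfl (g := fun _ => ENNReal.ofReal l), Finset.prod_const,
        Finset.card_erase_of_mem (Finset.mem_univ i), Finset.card_univ, Fintype.card_fin,
        Nat.add_sub_cancel]
      intro j hj
      rw [Function.update_of_ne (Finset.ne_of_mem_erase hj), Real.volume_Ico]
      congr 1
      ring
  rw [tsum_fintype, Finset.sum_congr rfl fun i _ => hslab i, Finset.sum_const, Finset.card_univ,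
    Fintype.card_fin, nsmul_eq_mul, volume_dyadicCube, ← hl, ← ENNReal.ofReal_pow hl0.le,
    ← ENNReal.ofReal_pow hl0.le, ← ENNReal.ofReal_natCast, ← ENNReal.ofReal_mul (by positivity),
    ← ENNReal.ofReal_mul (by positivity), ← ENNReal.ofReal_mul (by positivity)]
  refine ENNReal.ofReal_le_ofReal (le_of_eq ?_)
  field_simp
  ring

theorem setLIntegral_le_of_volume_inter_dyadicCube_le {k : ℤ} {D : Set (Fin n → ℝ)}
    (hD : MeasurableSet D) {c : ENNReal}
    (hc : ∀ m, volume (D ∩ dyadicCube k m) ≤ c * volume (dyadicCube k m))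
    (v : (Fin n → ℤ) → ENNReal) :
    ∫⁻ x in D, v (dyadicIndex k x) ≤ c * ∫⁻ x, v (dyadicIndex k x) := by
  have key : ∀ E : Set (Fin n → ℝ), MeasurableSet E →
      ∫⁻ x in E, v (dyadicIndex k x) = ∑' m, v m * volume (E ∩ dyadicCube k m) := by
    intro E hE
    have h1 : E = ⋃ m, E ∩ dyadicCube k m := by
      rw [← Set.inter_iUnion, iUnion_dyadicCube, Set.inter_univ]
    conv_lhs => rw [h1]
    rw [lintegral_iUnion (fun m => hE.inter (measurableSet_dyadicCube k m))
      (fun m m' hm => (pairwise_disjoint_dyadicCube k hm).mono Set.inter_subset_right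
        Set.inter_subset_right)]
    refine tsum_congr fun m => ?_
    rw [setLIntegral_congr_fun (g := fun _ => v m) (hE.inter (measurableSet_dyadicCube k m))
      (fun x hx => by simp only [mem_dyadicCube_iff.1 hx.2]), setLIntegral_const]
  rw [key D hD, ← setLIntegral_univ, key Set.univ MeasurableSet.univ, ← ENNReal.tsum_mul_left]
  refine ENNReal.tsum_le_tsum fun m => ?_
  rw [Set.univ_inter, mul_left_comm]
  exact mul_le_mul_right (hc m) _

theorem ENNReal.add_sq_le_two_mul (a b : ENNReal) : (a + b) ^ 2 ≤ 2 * (a ^ 2 + b ^ 2) := by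
  induction a using ENNReal.recTopCoe with
  | top => simp
  | coe a =>
    induction b using ENNReal.recTopCoe with
    | top => simp
    | coe b => exact_mod_cast add_sq_le (a := a) (b := b)

/-- The difference vanishes off the exit set. On it both terms are bounded separately; translation
turns the exit set of `z` into that of `-z`, so both integrals have the same form. -/
theorem lintegral_enorm_sub_translate_sq_le (k : ℤ) (z : Fin n → ℝ) (v : (Fin n → ℤ) → ℂ) :
    ∫⁻ x, ‖v (dyadicIndex k (x + z)) - v (dyadicIndex k x)‖ₑ ^ 2 ≤
      4 * (ENNReal.ofReal (min 1 (n * ‖z‖ / 2 ^ (-k))) * ∫⁻ x, ‖v (dyadicIndex k x)‖ₑ ^ 2) := by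
  set u : (Fin n → ℤ) → ENNReal := fun m => ‖v m‖ₑ ^ 2 with hu
  have hum : Measurable fun x : Fin n → ℝ => u (dyadicIndex k x) := by
    let _ : MeasurableSpace (Fin n → ℤ) := ⊤
    exact (measurable_from_top (f := u)).comp (measurable_dyadicIndex' k)
  set D := dyadicExit k z with hD
  have hDm : MeasurableSet D := measurableSet_dyadicExit k z
  have h1 : ∀ x, ‖v (dyadicIndex k (x + z)) - v (dyadicIndex k x)‖ₑ ^ 2 ≤
      2 * D.indicator (fun x => u (dyadicIndex k (x + z))) x +
        2 * D.indicator (fun x => u (dyadicIndex k x)) x := by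
    intro x
    by_cases hx : x ∈ D
    · rw [Set.indicator_of_mem hx, Set.indicator_of_mem hx, hu]
      simp only
      rw [← mul_add]
      have h2 := enorm_sub_le (a := v (dyadicIndex k (x + z))) (b := v (dyadicIndex k x))
      exact (pow_le_pow_left' h2 2).trans (ENNReal.add_sq_le_two_mul _ _)
    · have : dyadicIndex k (x + z) = dyadicIndex k x := not_not.1 hx
      rw [this, sub_self, enorm_zero]
      simp
  have hshift : ∫⁻ x, D.indicator (fun x => u (dyadicIndex k (x + z))) x =
      ∫⁻ x in dyadicExit k (-z), u (dyadicIndex k x) := by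
    rw [← lintegral_indicator (measurableSet_dyadicExit k (-z)),
      ← lintegral_add_right_eq_self
        ((dyadicExit k (-z)).indicator fun x => u (dyadicIndex k x)) z]
    refine lintegral_congr fun x => ?_
    have : x + z ∈ dyadicExit k (-z) ↔ x ∈ D := by
      simp only [hD, dyadicExit, Set.mem_ofPred_eq, add_neg_cancel_right]
      exact ne_comm
    by_cases hx : x ∈ D
    · rw [Set.indicator_of_mem hx, Set.indicator_of_mem (this.2 hx)]
    · rw [Set.indicator_of_notMem hx, Set.indicator_of_notMem (mt this.1 hx)]
  calc _ ≤ ∫⁻ x, (2 * D.indicator (fun x => u (dyadicIndex k (x + z))) x +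
        2 * D.indicator (fun x => u (dyadicIndex k x)) x) := lintegral_mono h1
    _ = 2 * (∫⁻ x in dyadicExit k (-z), u (dyadicIndex k x)) +
        2 * ∫⁻ x in D, u (dyadicIndex k x) := by
        rw [lintegral_add_right _ ((hum.indicator hDm).const_mul 2),
          lintegral_const_mul' _ _ ENNReal.ofNat_ne_top,
          lintegral_const_mul' _ _ ENNReal.ofNat_ne_top, hshift, lintegral_indicator hDm]
    _ ≤ 2 * (ENNReal.ofReal (min 1 (n * ‖z‖ / 2 ^ (-k))) * ∫⁻ x, u (dyadicIndex k x)) +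
        2 * (ENNReal.ofReal (min 1 (n * ‖z‖ / 2 ^ (-k))) * ∫⁻ x, u (dyadicIndex k x)) := by
        gcongr
        · refine setLIntegral_le_of_volume_inter_dyadicCube_le (measurableSet_dyadicExit k _)
            (fun m => ?_) u
          simpa using volume_dyadicExit_inter_le k (-z) m
        · exact setLIntegral_le_of_volume_inter_dyadicCube_le hDm
            (fun m => volume_dyadicExit_inter_le k z m) u
    _ = _ := by
        rw [← add_mul, show (2 : ENNReal) + 2 = 4 by norm_num]

/-- A fractional Sobolev bound for dyadic step functions. -/
theorem lintegral_lintegral_enorm_sub_sq_bracketKernel_le {γ ρ : ℝ} (hγ0 : 0 < γ) (hγ1 : γ ≤ 1)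
    (hρ : 0 < ρ) (k : ℤ) (v : (Fin n → ℤ) → ℂ) :
    ∫⁻ y, ∫⁻ x, ‖v (dyadicIndex k x) - v (dyadicIndex k y)‖ₑ ^ 2 *
        ENNReal.ofReal (bracketKernel n γ ρ (x - y)) ≤
      ENNReal.ofReal (4 * n ^ (γ / 2) * bracketConst n (γ / 2) * (ρ / 2 ^ (-k)) ^ (γ / 2)) *
        ∫⁻ x, ‖v (dyadicIndex k x)‖ₑ ^ 2 := by
  set l : ℝ := 2 ^ (-k) with hl
  have hl0 : 0 < l := by positivity
  have hb := bracketConst_nonneg n (γ / 2)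
  have hvm : Measurable fun x : Fin n → ℝ => v (dyadicIndex k x) := by
    let _ : MeasurableSpace (Fin n → ℤ) := ⊤
    exact (measurable_from_top (f := v)).comp (measurable_dyadicIndex' k)
  have hP := (measurable_bracketKernel (n := n) γ ρ).ennreal_ofReal
  set N := ∫⁻ x, ‖v (dyadicIndex k x)‖ₑ ^ 2 with hN
  -- Half of the decay exponent is traded: `min 1 x ≤ x^{γ/2}`, and `|z|^{γ/2}` is absorbed by the
  -- kernel, leaving an integrable one with exponent `γ/2`. This is the source of `γ/4` in the final
  -- bound.
  have hker : ∀ z : Fin n → ℝ, min 1 (n * ‖z‖ / l) * bracketKernel n γ ρ z ≤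
      n ^ (γ / 2) * (ρ / l) ^ (γ / 2) * bracketKernel n (γ / 2) ρ z := by
    intro z
    have h1 : min 1 (n * ‖z‖ / l) ≤ (n * ‖z‖ / l) ^ (γ / 2) := by
      rcases le_total 1 (n * ‖z‖ / l) with h | h
      · rw [min_eq_left h]
        exact Real.one_le_rpow h (by positivity)
      · rw [min_eq_right h]
        exact Real.self_le_rpow_of_le_one (by positivity) h (by linarith)
    have h2 : ‖z‖ ^ (γ / 2) ≤ (ρ + ‖z‖) ^ (γ / 2) := by
      gcongr
      linarith
    have hbk := bracketKernel_nonneg (n := n) (γ := γ) hρ z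
    calc min 1 (n * ‖z‖ / l) * bracketKernel n γ ρ z
        ≤ (n * ‖z‖ / l) ^ (γ / 2) * bracketKernel n γ ρ z := by gcongr
      _ = n ^ (γ / 2) / l ^ (γ / 2) * ‖z‖ ^ (γ / 2) * bracketKernel n γ ρ z := by
          rw [Real.div_rpow (by positivity) hl0.le, Real.mul_rpow (by positivity) (norm_nonneg _)]
          ring
      _ ≤ n ^ (γ / 2) / l ^ (γ / 2) * (ρ + ‖z‖) ^ (γ / 2) * bracketKernel n γ ρ z := by gcongr
      _ = _ := by
          rw [bracketKernel, bracketKernel, Real.div_rpow hρ.le hl0.le]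
          have e1 : ρ ^ γ = ρ ^ (γ / 2) * ρ ^ (γ / 2) := by
            rw [← Real.rpow_add hρ, add_halves]
          have e2 : (ρ + ‖z‖) ^ ((n : ℝ) + γ) =
              (ρ + ‖z‖) ^ ((n : ℝ) + γ / 2) * (ρ + ‖z‖) ^ (γ / 2) := by
            rw [← Real.rpow_add (by positivity)]
            congr 1
            ring
          rw [e1, e2]
          field_simp
  calc ∫⁻ y, ∫⁻ x, ‖v (dyadicIndex k x) - v (dyadicIndex k y)‖ₑ ^ 2 *
        ENNReal.ofReal (bracketKernel n γ ρ (x - y))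
      = ∫⁻ y, ∫⁻ z, ‖v (dyadicIndex k (y + z)) - v (dyadicIndex k y)‖ₑ ^ 2 *
        ENNReal.ofReal (bracketKernel n γ ρ z) := by
        refine lintegral_congr fun y => ?_
        rw [← lintegral_add_left_eq_self _ y]
        simp only [add_sub_cancel_left]
    _ = ∫⁻ z, ∫⁻ y, ‖v (dyadicIndex k (y + z)) - v (dyadicIndex k y)‖ₑ ^ 2 *
        ENNReal.ofReal (bracketKernel n γ ρ z) := by
        rw [lintegral_lintegral_swap]
        exact ((((hvm.comp (measurable_fst.add measurable_snd)).sub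
          (hvm.comp measurable_fst)).enorm.pow_const 2).mul
          (hP.comp measurable_snd)).aemeasurable
    _ ≤ ∫⁻ z, (4 * (ENNReal.ofReal (min 1 (n * ‖z‖ / l)) * N)) *
        ENNReal.ofReal (bracketKernel n γ ρ z) := by
        refine lintegral_mono fun z => ?_
        simp only
        rw [lintegral_mul_const' _ _ ENNReal.ofReal_ne_top]
        gcongr
        exact lintegral_enorm_sub_translate_sq_le k z v
    _ ≤ ∫⁻ z, (4 * ENNReal.ofReal (n ^ (γ / 2) * (ρ / l) ^ (γ / 2)) * N) *
        ENNReal.ofReal (bracketKernel n (γ / 2) ρ z) := by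
        refine lintegral_mono fun z => ?_
        calc _ = 4 * N * (ENNReal.ofReal (min 1 (n * ‖z‖ / l)) *
              ENNReal.ofReal (bracketKernel n γ ρ z)) := by ring
          _ ≤ 4 * N * (ENNReal.ofReal (n ^ (γ / 2) * (ρ / l) ^ (γ / 2)) *
              ENNReal.ofReal (bracketKernel n (γ / 2) ρ z)) := by
              rw [← ENNReal.ofReal_mul (by positivity), ← ENNReal.ofReal_mul (by positivity)]
              exact mul_le_mul_right (ENNReal.ofReal_le_ofReal (hker z)) _
          _ = _ := by ring
    _ = _ := by
        rw [lintegral_const_mul _ (measurable_bracketKernel (γ / 2) ρ).ennreal_ofReal,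
          lintegral_bracketKernel (by positivity) hρ]
        rw [show 4 * (n : ℝ) ^ (γ / 2) * bracketConst n (γ / 2) * (ρ / l) ^ (γ / 2) =
          4 * ((n ^ (γ / 2) * (ρ / l) ^ (γ / 2)) * bracketConst n (γ / 2)) by ring]
        rw [ENNReal.ofReal_mul (p := 4) (by positivity), ENNReal.ofReal_ofNat,
          ENNReal.ofReal_mul (q := bracketConst n (γ / 2)) (by positivity)]
        ring

end StepFunctions

/-! ### The kernel representation and Hardy space functions -/

section Representation

variable {n : ℕ} {K : (Fin n → ℝ) → (Fin n → ℝ) → ℂ} {A γ : ℝ} {T : L2 n →L[ℂ] L2 n}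

/-- At a fixed `x` this is the pairing with an `L₂` function, so the kernel formula passes to `L₂`
limits of test functions. -/
theorem IsCalderonZygmund.continuous_truncIntegral (hK : IsCalderonZygmund γ A K T) (hA : 0 ≤ A)
    (hn : 1 ≤ n) (hγ : 0 < γ) {ε : ℝ} (hε : 0 < ε) (x : Fin n → ℝ) :
    Continuous fun h : L2 n => truncIntegral K ε h x := by
  have hJ : MemLp (fun y => starRingEnd ℂ (truncKernel K ε x y)) 2 volume :=
    (hK.memLp_truncKernel hA hn hγ hε x).star
  have : (fun h : L2 n => truncIntegral K ε h x) = fun h => inner ℂ (hJ.toLp _) h := by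
    ext h
    rw [MeasureTheory.L2.inner_def, truncIntegral]
    refine integral_congr_ae ?_
    filter_upwards [hJ.coeFn_toLp] with y hy
    simp [hy, mul_comm]
  rw [this]
  fun_prop

/-- A smooth approximant is multiplied by a bump equal to 1 on the ball. Since `h` vanishes
elsewhere and the bump is at most 1, the error does not grow. -/
theorem exists_contDiff_approx_of_support_subset {h : L2 n} {c : Fin n → ℝ} {ρ : ℝ} (hρ : 0 < ρ)
    (hsupp : ∀ᵐ y, y ∉ Metric.closedBall c ρ → h y = 0) {η : ℝ} (hη : 0 < η) :
    ∃ (φ : (Fin n → ℝ) → ℂ) (f : L2 n), ContDiff ℝ ∞ φ ∧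
      tsupport φ ⊆ Metric.closedBall c (3 * ρ / 2) ∧ f =ᵐ[volume] φ ∧ ‖f - h‖ ≤ η := by
  obtain ⟨g, hg1, hg2, hg3⟩ := (Lp.memLp h).exist_eLpNorm_sub_le ENNReal.ofNat_ne_top one_le_two hη
  let χ : ContDiffBump c := ⟨ρ, 3 * ρ / 2, hρ, by linarith⟩
  have hφ : ContDiff ℝ ∞ fun x => (χ x : ℂ) * g x :=
    (Complex.ofRealCLM.contDiff.comp χ.contDiff).mul hg2
  have hts : tsupport (fun x => (χ x : ℂ) * g x) ⊆ Metric.closedBall c (3 * ρ / 2) := by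
    refine closure_minimal (fun x hx => ?_) Metric.isClosed_closedBall
    by_contra hx'
    rw [Metric.mem_closedBall, not_le] at hx'
    have : χ x = 0 := χ.zero_of_le_dist hx'.le
    simp [this] at hx
  have hcs : HasCompactSupport fun x => (χ x : ℂ) * g x :=
    (isCompact_closedBall c (3 * ρ / 2)).of_isClosed_subset (isClosed_tsupport _) hts
  have hL : MemLp (fun x => (χ x : ℂ) * g x) 2 volume :=
    hφ.continuous.memLp_of_hasCompactSupport hcs
  refine ⟨_, hL.toLp, hφ, hts, hL.coeFn_toLp, ?_⟩
  rw [Lp.norm_def]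
  refine ENNReal.toReal_le_of_le_ofReal hη.le (le_trans ?_ hg3)
  refine eLpNorm_mono_ae ?_
  filter_upwards [Lp.coeFn_sub hL.toLp h, hL.coeFn_toLp, hsupp] with x h1 h2 h3
  rw [h1, Pi.sub_apply, h2, Pi.sub_apply]
  by_cases hx : x ∈ Metric.closedBall c ρ
  · rw [χ.one_of_mem_closedBall hx, Complex.ofReal_one, one_mul, norm_sub_rev]
  · rw [h3 hx, sub_zero, zero_sub, norm_neg, norm_mul, Complex.norm_real,
      Real.norm_of_nonneg χ.nonneg]
    exact mul_le_of_le_one_left (norm_nonneg _) χ.le_one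

/-- The kernel representation for `L₂` functions that vanish off a ball. -/
theorem IsCalderonZygmund.ae_eq_truncIntegral (hK : IsCalderonZygmund γ A K T) (hA : 0 ≤ A)
    (hn : 1 ≤ n) (hγ : 0 < γ) {h : L2 n} {c : Fin n → ℝ} {ρ : ℝ} (hρ : 0 < ρ)
    (hsupp : ∀ᵐ y, y ∉ Metric.closedBall c ρ → h y = 0) :
    ∀ᵐ x, 2 * ρ ≤ dist x c → T h x = truncIntegral K (ρ / 4) h x := by
  choose φ f hφ hts hf hfh using fun N : ℕ =>
    exists_contDiff_approx_of_support_subset hρ hsupp (η := 1 / ((N : ℝ) + 1)) (by positivity)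
  have hlim : Tendsto f atTop (𝓝 h) := by
    rw [tendsto_iff_norm_sub_tendsto_zero]
    exact squeeze_zero (fun _ => norm_nonneg _) hfh tendsto_one_div_add_atTop_nhds_zero_nat
  have hTlim : Tendsto (fun N => T (f N)) atTop (𝓝 (T h)) := (T.continuous.tendsto h).comp hlim
  obtain ⟨ns, hns, hae⟩ := (tendstoInMeasure_of_tendsto_Lp hTlim).exists_seq_tendsto_ae
  have hcs : ∀ N, HasCompactSupport (φ N) := fun N =>
    (isCompact_closedBall c (3 * ρ / 2)).of_isClosed_subset (isClosed_tsupport _) (hts N)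
  have hker : ∀ᵐ x, ∀ N, x ∉ tsupport (φ N) → T (f N) x = ∫ y, K x y * φ N y :=
    ae_all_iff.2 fun N => hK.kernel (φ N) (f N) (hφ N) (hcs N) (hf N)
  filter_upwards [hae, hker] with x hx1 hx2 hx
  have h1 : ∀ N, T (f N) x = truncIntegral K (ρ / 4) (f N) x := by
    intro N
    rw [hx2 N fun hmem => by
      have := hts N hmem
      rw [Metric.mem_closedBall] at this
      linarith, truncIntegral]
    refine integral_congr_ae ?_
    filter_upwards [hf N] with y hy
    rw [hy]
    -- There `|x - y| ≥ 2ρ - 3ρ/2 > ρ/4`, so the truncation does not act.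
    by_cases hy' : y ∈ tsupport (φ N)
    · have h2 := hts N hy'
      rw [Metric.mem_closedBall] at h2
      have h3 := dist_triangle x y c
      rw [truncKernel, if_pos (by linarith)]
    · rw [image_eq_zero_of_notMem_tsupport hy', mul_zero, mul_zero]
  simp_rw [h1] at hx1
  exact tendsto_nhds_unique hx1
    (((hK.continuous_truncIntegral hA hn hγ (by positivity) x).tendsto h).comp
      (hlim.comp hns.tendsto_atTop))

/-- A normalization makes `h` a multiple of a single atom, so the atomic series has one nonzero
term. -/
theorem memHardyOne_of_bounded {h : L2 n} {c : Fin n → ℝ} {r M : ℝ} (hr : 0 < r)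
    (hsupp : ∀ᵐ y, y ∉ Metric.closedBall c r → h y = 0) (hM : ∀ᵐ y, ‖h y‖ ≤ M)
    (hint : Integrable h volume) (h0 : ∫ y, h y = 0) :
    MemHardyOne (h : (Fin n → ℝ) → ℂ) := by
  set V := volume.real (Metric.closedBall c r) with hV
  have hV0 : 0 < V :=
    ENNReal.toReal_pos (Metric.measure_closedBall_pos volume c hr).ne' measure_closedBall_lt_top.ne
  set b : ℝ := (|M| + 1) * V with hb
  have hb0 : 0 < b := by positivity
  set a : (Fin n → ℝ) → ℂ := fun x => (b : ℂ)⁻¹ * (Metric.closedBall c r).indicator h x with ha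
  have hae : a =ᵐ[volume] fun x => (b : ℂ)⁻¹ * h x := by
    filter_upwards [hsupp] with x hx
    simp only [ha]
    by_cases hx' : x ∈ Metric.closedBall c r
    · rw [Set.indicator_of_mem hx']
    · rw [Set.indicator_of_notMem hx', hx hx']
  have hbc : (b : ℂ) ≠ 0 := by exact_mod_cast hb0.ne'
  have hatom : IsHardyAtom a := by
    refine ⟨((Lp.aestronglyMeasurable h).const_mul _).congr hae.symm,
      ⟨c, r, hr, fun x hx => ?_, ?_⟩, ?_⟩
    · by_contra hx'
      refine hx ?_
      simp only [ha]
      rw [Set.indicator_of_notMem hx', mul_zero]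
    · filter_upwards [hae, hM] with x hx hx2
      rw [hx, norm_mul, norm_inv, Complex.norm_real, Real.norm_of_nonneg hb0.le, ← hV, hb, mul_inv]
      have h1 : ‖h x‖ ≤ |M| + 1 := hx2.trans ((le_abs_self M).trans (by linarith))
      calc (|M| + 1)⁻¹ * V⁻¹ * ‖h x‖ ≤ (|M| + 1)⁻¹ * V⁻¹ * (|M| + 1) := by gcongr
        _ = V⁻¹ := by field_simp
    · rw [integral_congr_ae hae, integral_const_mul, h0, mul_zero]
  refine ⟨hint, fun j => if j = 0 then (b : ℂ) else 0, fun _ => a, fun _ => hatom, ?_, ?_⟩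
  · refine summable_of_ne_finset_zero (s := {0}) fun j hj => ?_
    simp only
    rw [if_neg (by simpa using hj), norm_zero]
  · refine tendsto_const_nhds.congr' ?_
    filter_upwards [eventually_gt_atTop 0] with N hN
    symm
    refine (eLpNorm_congr_ae (g := fun _ => (0 : ℂ)) ?_).trans eLpNorm_zero'
    filter_upwards [hae] with x hx
    rw [Finset.sum_eq_single 0 (fun j _ hj => by rw [if_neg hj, zero_mul])
      (fun h' => absurd (Finset.mem_range.2 hN) h'), if_pos rfl, hx, mul_inv_cancel_left₀ hbc,
      sub_self]

end Representation

/-! ### Singular integrals of functions with mean zero on a dyadic cube -/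

section Local

variable {n : ℕ} {K : (Fin n → ℝ) → (Fin n → ℝ) → ℂ} {A γ : ℝ} {T : L2 n →L[ℂ] L2 n}

theorem dyadicCube_subset_closedBall (j : ℤ) (m : Fin n → ℤ) :
    dyadicCube j m ⊆ Metric.closedBall (dyadicPoint j m) ((2 : ℝ) ^ (-j)) := by
  intro y hy
  rw [Metric.mem_closedBall]
  exact dist_le_of_dyadicIndex_eq (by rw [mem_dyadicCube_iff.1 hy, dyadicIndex_dyadicPoint])

theorem volume_dyadicCube_lt_top (j : ℤ) (m : Fin n → ℤ) : volume (dyadicCube j m) < ⊤ := by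
  rw [volume_dyadicCube]
  exact ENNReal.pow_lt_top ENNReal.ofReal_lt_top

theorem integrable_of_support_dyadicCube {h : L2 n} {j : ℤ} {m : Fin n → ℤ}
    (hsupp : ∀ᵐ y, y ∉ dyadicCube j m → h y = 0) : Integrable h volume := by
  have h1 : IntegrableOn h (dyadicCube j m) volume :=
    integrableOn_Lp_of_measure_ne_top h fact_one_le_two_ennreal.elim
      (volume_dyadicCube_lt_top j m).ne
  rw [← integrable_indicator_iff (measurableSet_dyadicCube j m)] at h1
  refine h1.congr ?_
  filter_upwards [hsupp] with y hy
  by_cases hy' : y ∈ dyadicCube j m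
  · rw [Set.indicator_of_mem hy']
  · rw [Set.indicator_of_notMem hy', hy hy']

/-- Away from the cube, `T h` is controlled by the regularity of the kernel. -/
theorem IsCalderonZygmund.enorm_apply_le_of_far (hK : IsCalderonZygmund γ A K T) (hA : 0 ≤ A)
    (hn : 1 ≤ n) (hγ : 0 < γ) {h : L2 n} {j : ℤ} {m : Fin n → ℤ}
    (hsupp : ∀ᵐ y, y ∉ dyadicCube j m → h y = 0) (h0 : ∫ y, h y = 0) :
    ∀ᵐ x, 2 * (2 : ℝ) ^ (-j) ≤ dist x (dyadicPoint j m) → ‖T h x‖ₑ ≤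
      ∫⁻ y in dyadicCube j m, ENNReal.ofReal
        (A * 2 ^ ((n : ℝ) + γ) * bracketKernel n γ (2 ^ (-j)) (x - y)) * ‖h y‖ₑ := by
  set ρ : ℝ := 2 ^ (-j) with hρ
  have hρ0 : 0 < ρ := by positivity
  set c := dyadicPoint j m with hc
  have hball : ∀ᵐ y, y ∉ Metric.closedBall c ρ → h y = 0 := by
    filter_upwards [hsupp] with y hy hy'
    exact hy fun h => hy' (dyadicCube_subset_closedBall j m h)
  have hε : 0 < ρ / 4 := by positivity
  filter_upwards [hK.ae_eq_truncIntegral hA hn hγ hρ0 hball] with x hx hfar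
  have hint := integrable_of_support_dyadicCube hsupp
  have h1 : truncIntegral K (ρ / 4) h x =
      ∫ y, (truncKernel K (ρ / 4) x y - truncKernel K (ρ / 4) x c) * h y := by
    simp_rw [sub_mul]
    rw [integral_sub (hK.integrable_truncKernel_mul hA hn hγ hε h x) (hint.const_mul _),
      integral_const_mul, h0, mul_zero, sub_zero, truncIntegral]
  rw [hx hfar, h1]
  refine (enorm_integral_le_lintegral_enorm _).trans ?_
  rw [← lintegral_indicator (measurableSet_dyadicCube j m)]
  refine lintegral_mono_ae ?_
  filter_upwards [hsupp] with y hy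
  by_cases hyR : y ∈ dyadicCube j m
  · rw [Set.indicator_of_mem hyR, enorm_mul]
    gcongr
    rw [← ofReal_norm]
    refine ENNReal.ofReal_le_ofReal ?_
    have hyc : dist y c ≤ ρ := dyadicCube_subset_closedBall j m hyR
    have h2 := dist_triangle x y c
    have h3 := dist_triangle x c y
    rw [dist_comm c y] at h3
    rw [truncKernel, truncKernel, if_pos (by linarith), if_pos (by linarith), norm_sub_rev]
    refine (hK.smooth_right x c y (dist_pos.1 (by linarith))
      (by rw [dist_comm]; linarith)).trans ?_
    rw [bracketKernel, ← dist_eq_norm, dist_comm c y]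
    calc A * dist y c ^ γ / dist x c ^ ((n : ℝ) + γ)
        ≤ A * ρ ^ γ / ((ρ + dist x y) / 2) ^ ((n : ℝ) + γ) := by
          gcongr
          linarith
      _ = _ := by
          rw [Real.div_rpow (by positivity) (by positivity)]
          field_simp
  · rw [hy hyR, mul_zero, enorm_zero]
    exact zero_le

theorem lintegral_lintegral_bracketKernel_mul {ρ : ℝ} (hγ : 0 < γ) (hρ : 0 < ρ)
    {u : (Fin n → ℝ) → ENNReal} (hu : Measurable u) (R : Set (Fin n → ℝ)) :
    ∫⁻ x, ∫⁻ y in R, ENNReal.ofReal (bracketKernel n γ ρ (x - y)) * u y =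
      ENNReal.ofReal (bracketConst n γ) * ∫⁻ y in R, u y := by
  have hP := (measurable_bracketKernel (n := n) γ ρ).ennreal_ofReal
  rw [lintegral_lintegral_swap ((hP.comp (measurable_fst.sub measurable_snd)).mul
    (hu.comp measurable_snd)).aemeasurable, ← lintegral_const_mul _ hu]
  refine lintegral_congr fun y => ?_
  rw [lintegral_mul_const _ (show Measurable fun x => ENNReal.ofReal (bracketKernel n γ ρ (x - y))
    from hP.comp (measurable_id.sub_const y))]
  congr 1
  rw [lintegral_sub_right_eq_self (fun z => ENNReal.ofReal (bracketKernel n γ ρ z)) y,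
    lintegral_bracketKernel hγ hρ]

theorem measurable_enorm_Lp (h : L2 n) : Measurable fun y => ‖h y‖ₑ :=
  (Lp.stronglyMeasurable h).measurable.enorm

/-- `L₂` suffices on a ball about the cube, kernel decay outside. Without integrability, `∫ T h = 0`
could hold merely by the default value of the integral, and constants could not be subtracted. -/
theorem IsCalderonZygmund.integrable_apply (hK : IsCalderonZygmund γ A K T) (hA : 0 ≤ A)
    (hn : 1 ≤ n) (hγ : 0 < γ) {h : L2 n} {j : ℤ} {m : Fin n → ℤ}
    (hsupp : ∀ᵐ y, y ∉ dyadicCube j m → h y = 0) (h0 : ∫ y, h y = 0) :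
    Integrable (T h) volume := by
  set ρ : ℝ := 2 ^ (-j) with hρ
  have hρ0 : 0 < ρ := by positivity
  set N : Set (Fin n → ℝ) := Metric.ball (dyadicPoint j m) (2 * ρ) with hN
  have h1 : IntegrableOn (T h) N volume :=
    integrableOn_Lp_of_measure_ne_top _ fact_one_le_two_ennreal.elim measure_ball_lt_top.ne
  have h2 : IntegrableOn (T h) Nᶜ volume := by
    refine ⟨(Lp.aestronglyMeasurable _).restrict, ?_⟩
    rw [hasFiniteIntegral_iff_enorm]
    calc ∫⁻ x in Nᶜ, ‖T h x‖ₑ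
        ≤ ∫⁻ x in Nᶜ, ∫⁻ y in dyadicCube j m, ENNReal.ofReal (A * 2 ^ ((n : ℝ) + γ)) *
            (ENNReal.ofReal (bracketKernel n γ ρ (x - y)) * ‖h y‖ₑ) := by
          refine lintegral_mono_ae ?_
          filter_upwards [ae_restrict_of_ae (hK.enorm_apply_le_of_far hA hn hγ hsupp h0),
            ae_restrict_mem measurableSet_ball.compl] with x hx hxN
          rw [hN, Set.mem_compl_iff, Metric.mem_ball, not_lt] at hxN
          refine (hx hxN).trans (le_of_eq (lintegral_congr fun y => ?_))
          rw [ENNReal.ofReal_mul (by positivity), mul_assoc]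
      _ ≤ ∫⁻ x, ∫⁻ y in dyadicCube j m, ENNReal.ofReal (A * 2 ^ ((n : ℝ) + γ)) *
            (ENNReal.ofReal (bracketKernel n γ ρ (x - y)) * ‖h y‖ₑ) :=
          setLIntegral_le_lintegral _ _
      _ = ENNReal.ofReal (A * 2 ^ ((n : ℝ) + γ)) * (ENNReal.ofReal (bracketConst n γ) *
            ∫⁻ y in dyadicCube j m, ‖h y‖ₑ) := by
          rw [← lintegral_lintegral_bracketKernel_mul hγ hρ0 (measurable_enorm_Lp h)]
          simp_rw [lintegral_const_mul' _ _ ENNReal.ofReal_ne_top]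
      _ < ⊤ := by
          refine ENNReal.mul_lt_top ENNReal.ofReal_lt_top
            (ENNReal.mul_lt_top ENNReal.ofReal_lt_top ?_)
          exact (setLIntegral_le_lintegral _ _).trans_lt
            (hasFiniteIntegral_iff_enorm.1 (integrable_of_support_dyadicCube hsupp).2)
  rw [← integrableOn_univ, ← Set.union_compl_self N]
  exact h1.union h2

theorem ENNReal.mul_le_mul_sq_add_inv_mul_sq (a b : ENNReal) {t : NNReal} (ht : t ≠ 0) :
    a * b ≤ t * a ^ 2 + (t : ENNReal)⁻¹ * b ^ 2 := by
  have ht' : (t : ENNReal) ≠ 0 := by exact_mod_cast ht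
  rcases le_total ((t : ENNReal) * a) b with h | h
  · refine le_trans ?_ le_add_self
    have : a ≤ (t : ENNReal)⁻¹ * b := by
      rw [← ENNReal.div_eq_inv_mul, ENNReal.le_div_iff_mul_le (Or.inl ht')
        (Or.inl ENNReal.coe_ne_top), mul_comm]
      exact h
    calc a * b ≤ ((t : ENNReal)⁻¹ * b) * b := by gcongr
      _ = _ := by ring
  · refine le_trans ?_ le_self_add
    calc a * b ≤ a * (t * a) := by gcongr
      _ = _ := by ring

theorem lintegral_lintegral_mul_add_mul {α β : Type*} [MeasurableSpace α] [MeasurableSpace β]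
    {μ : Measure α} {ν : Measure β} [SFinite μ] [SFinite ν] {f g : α → β → ENNReal}
    (hf : Measurable fun p : α × β => f p.1 p.2)
    {C t s : ENNReal} (hC : C ≠ ⊤) (ht : t ≠ ⊤) (hs : s ≠ ⊤) :
    ∫⁻ x, ∫⁻ y, C * (t * f x y + s * g x y) ∂ν ∂μ =
      C * (t * (∫⁻ y, ∫⁻ x, f x y ∂μ ∂ν) + s * ∫⁻ x, ∫⁻ y, g x y ∂ν ∂μ) := by
  have h1 : ∀ x, ∫⁻ y, C * (t * f x y + s * g x y) ∂ν =
      C * (t * (∫⁻ y, f x y ∂ν) + s * ∫⁻ y, g x y ∂ν) := by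
    intro x
    have hfx : Measurable (f x) := hf.comp measurable_prodMk_left
    rw [lintegral_const_mul' _ _ hC, lintegral_add_left (hfx.const_mul _),
      lintegral_const_mul' _ _ ht, lintegral_const_mul' _ _ hs]
  have hfi : Measurable fun x => ∫⁻ y, f x y ∂ν := hf.lintegral_prod_right'
  simp_rw [h1]
  rw [lintegral_const_mul' _ _ hC, lintegral_add_left (hfi.const_mul _),
    lintegral_const_mul' _ _ ht, lintegral_const_mul' _ _ hs,
    lintegral_lintegral_swap hf.aemeasurable]

/-- The constant in `IsCalderonZygmund.enorm_inner_apply_le`. -/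
noncomputable def pairingConst (n : ℕ) (γ : ℝ) : ℝ :=
  4 ^ ((n : ℝ) + γ) + 2 ^ ((n : ℝ) + γ) + 1 + 2 ^ ((n : ℝ) + γ) * bracketConst n γ

theorem norm_sq_eq_lintegral (h : L2 n) : ENNReal.ofReal (‖h‖ ^ 2) = ∫⁻ y, ‖h y‖ₑ ^ 2 := by
  rw [← eLpNorm_two_sq, Lp.norm_def, ← ENNReal.toReal_pow, ENNReal.ofReal_toReal
    (ENNReal.pow_ne_top (Lp.eLpNorm_ne_top h))]

/-- Pairing of a dyadic step function with the image of a function of mean zero on a smaller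
cube. -/
theorem IsCalderonZygmund.enorm_inner_apply_le (hK : IsCalderonZygmund γ A K T) (hA : 1 ≤ A)
    (hn : 1 ≤ n) (hγ : 0 < γ) (hT : ‖T‖ ≤ 1) {h : L2 n} {j k : ℤ} (hkj : k ≤ j)
    {m : Fin n → ℤ} (hsupp : ∀ᵐ y, y ∉ dyadicCube j m → h y = 0) (h0 : ∫ y, h y = 0)
    (hT0 : ∫ x, T h x = 0) {F : L2 n} {v : (Fin n → ℤ) → ℂ}
    (hF : F =ᵐ[volume] fun x => v (dyadicIndex k x)) {t : NNReal} (ht : t ≠ 0) :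
    ‖inner ℂ F (T h)‖ₑ ≤ ENNReal.ofReal (A * pairingConst n γ) *
      (t * (∫⁻ y in dyadicCube j m, ∫⁻ x, ‖v (dyadicIndex k x) - v (dyadicIndex k y)‖ₑ ^ 2 *
        ENNReal.ofReal (bracketKernel n γ (2 ^ (-j)) (x - y))) +
        (t : ENNReal)⁻¹ * ∫⁻ y in dyadicCube j m, ‖h y‖ₑ ^ 2) := by
  set ρ : ℝ := 2 ^ (-j) with hρ
  have hρ0 : 0 < ρ := by positivity
  set R := dyadicCube j m with hR
  set c := dyadicPoint j m with hc
  set N : Set (Fin n → ℝ) := Metric.ball c (2 * ρ) with hN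
  set a := v (dyadicIndex k c) with ha
  set E := (n : ℝ) + γ with hE
  have hA0 : 0 ≤ A := by linarith
  have hbc := bracketConst_nonneg n γ
  set I := ∫⁻ y in R, ∫⁻ x, ‖v (dyadicIndex k x) - v (dyadicIndex k y)‖ₑ ^ 2 *
        ENNReal.ofReal (bracketKernel n γ ρ (x - y)) with hI
  set H := ∫⁻ y in R, ‖h y‖ₑ ^ 2 with hH
  have hvm : Measurable fun x : Fin n → ℝ => v (dyadicIndex k x) := by
    let _ : MeasurableSpace (Fin n → ℤ) := ⊤
    exact (measurable_from_top (f := v)).comp (measurable_dyadicIndex' k)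
  have hP := (measurable_bracketKernel (n := n) γ ρ).ennreal_ofReal
  have hRc : ∀ y ∈ R, v (dyadicIndex k y) = a := fun y hy => by
    rw [ha, dyadicIndex_eq_of_le hkj]
    rw [mem_dyadicCube_iff.1 hy, hc, dyadicIndex_dyadicPoint]
  have hHall : ∫⁻ y, ‖h y‖ₑ ^ 2 = H := by
    rw [hH, ← lintegral_indicator (measurableSet_dyadicCube j m)]
    refine lintegral_congr_ae ?_
    filter_upwards [hsupp] with y hy
    by_cases hyR : y ∈ R
    · rw [Set.indicator_of_mem hyR]
    · rw [Set.indicator_of_notMem hyR, hy hyR]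
      simp
  have hTH : ∫⁻ x, ‖T h x‖ₑ ^ 2 ≤ H := by
    rw [← hHall, ← norm_sq_eq_lintegral, ← norm_sq_eq_lintegral]
    refine ENNReal.ofReal_le_ofReal ?_
    have : ‖T h‖ ≤ 1 * ‖h‖ := T.le_of_opNorm_le hT h
    rw [one_mul] at this
    gcongr
  have hTint := hK.integrable_apply hA0 hn hγ hsupp h0
  -- Cancellation of `T h` allows subtraction of `a`, the value of `F` on the whole of `R` because
  -- `k ≤ j`.
  have hinner : inner ℂ F (T h) =
      ∫ x, starRingEnd ℂ (v (dyadicIndex k x) - a) * T h x := by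
    have h1 : inner ℂ F (T h) = ∫ x, starRingEnd ℂ (v (dyadicIndex k x)) * T h x := by
      rw [MeasureTheory.L2.inner_def]
      refine integral_congr_ae ?_
      filter_upwards [hF] with x hx
      simp [hx, mul_comm]
    have h2 : Integrable (fun x => starRingEnd ℂ (v (dyadicIndex k x)) * T h x) volume := by
      have h3 : MemLp (fun x => starRingEnd ℂ (v (dyadicIndex k x))) 2 volume :=
        ((memLp_congr_ae hF).1 (Lp.memLp F)).star
      exact h3.integrable_mul (Lp.memLp (T h))
    simp_rw [map_sub, sub_mul]
    rw [integral_sub h2 (hTint.const_mul _), integral_const_mul, hT0, mul_zero, sub_zero, h1]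
  have hnear : ∫⁻ x in N, ‖v (dyadicIndex k x) - a‖ₑ * ‖T h x‖ₑ ≤
      t * (ENNReal.ofReal (4 ^ E) * I) + (t : ENNReal)⁻¹ * H := by
    -- For `x ∈ N` and `y ∈ R` one has `|x - y| ≤ 3ρ`, so the kernel is at least `ρ⁻ⁿ 4^{-(n+γ)}`;
    -- averaging over `R`, of volume `ρⁿ`, bounds the near part by `I`.
    have h1 : ∫⁻ x in N, ‖v (dyadicIndex k x) - a‖ₑ ^ 2 ≤ ENNReal.ofReal (4 ^ E) * I := by
      have h2 : ENNReal.ofReal (ρ ^ n) * (ENNReal.ofReal ((ρ ^ n)⁻¹ * (4 ^ E)⁻¹) *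
          ∫⁻ x in N, ‖v (dyadicIndex k x) - a‖ₑ ^ 2) ≤ I := by
        have hvolR : volume R = ENNReal.ofReal (ρ ^ n) := by
          rw [hR, volume_dyadicCube, ENNReal.ofReal_pow hρ0.le]
        rw [← hvolR, mul_comm (volume R), ← setLIntegral_const, hI]
        refine setLIntegral_mono' (measurableSet_dyadicCube j m) fun y hy => ?_
        rw [← lintegral_const_mul' _ _ ENNReal.ofReal_ne_top]
        refine le_trans ?_ (setLIntegral_le_lintegral N _)
        refine setLIntegral_mono' measurableSet_ball fun x hx => ?_
        rw [hRc y hy, mul_comm]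
        gcongr
        rw [bracketKernel, ← dist_eq_norm]
        have h3 : dist x y ≤ 3 * ρ := by
          have h4 : dist y c ≤ ρ := dyadicCube_subset_closedBall j m hy
          have h5 := dist_triangle x c y
          rw [hN, Metric.mem_ball] at hx
          rw [dist_comm c y] at h5
          linarith
        calc (ρ ^ n)⁻¹ * (4 ^ E)⁻¹ = ρ ^ γ / (4 * ρ) ^ E := by
              rw [hE, Real.mul_rpow (x := 4) (by norm_num) hρ0.le, Real.rpow_add hρ0,
                Real.rpow_natCast]
              have : ρ ^ γ ≠ 0 := by positivity
              field_simp
          _ ≤ _ := by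
              gcongr
              linarith
      calc _ = ENNReal.ofReal (4 ^ E) * (ENNReal.ofReal (ρ ^ n) *
            (ENNReal.ofReal ((ρ ^ n)⁻¹ * (4 ^ E)⁻¹) *
            ∫⁻ x in N, ‖v (dyadicIndex k x) - a‖ₑ ^ 2)) := by
            rw [← mul_assoc, ← mul_assoc, ← ENNReal.ofReal_mul (by positivity),
              ← ENNReal.ofReal_mul (by positivity)]
            have : (4 : ℝ) ^ E * ρ ^ n * ((ρ ^ n)⁻¹ * (4 ^ E)⁻¹) = 1 := by field_simp
            rw [this, ENNReal.ofReal_one, one_mul]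
        _ ≤ _ := by gcongr
    calc _ ≤ ∫⁻ x in N, (t * ‖v (dyadicIndex k x) - a‖ₑ ^ 2 +
          (t : ENNReal)⁻¹ * ‖T h x‖ₑ ^ 2) :=
          lintegral_mono fun x => ENNReal.mul_le_mul_sq_add_inv_mul_sq _ _ ht
      _ = t * (∫⁻ x in N, ‖v (dyadicIndex k x) - a‖ₑ ^ 2) +
          (t : ENNReal)⁻¹ * ∫⁻ x in N, ‖T h x‖ₑ ^ 2 := by
          have hm1 : Measurable fun x => ‖T h x‖ₑ ^ 2 := (measurable_enorm_Lp (T h)).pow_const 2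
          rw [lintegral_add_right _ (hm1.const_mul _), lintegral_const_mul _ hm1,
            lintegral_const_mul' _ _ ENNReal.coe_ne_top]
      _ ≤ _ := by
          gcongr
          exact (setLIntegral_le_lintegral _ _).trans hTH
  have hfar : ∫⁻ x in Nᶜ, ‖v (dyadicIndex k x) - a‖ₑ * ‖T h x‖ₑ ≤
      ENNReal.ofReal (A * 2 ^ E) * (t * I +
        (t : ENNReal)⁻¹ * (ENNReal.ofReal (bracketConst n γ) * H)) := by
    calc ∫⁻ x in Nᶜ, ‖v (dyadicIndex k x) - a‖ₑ * ‖T h x‖ₑ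
        ≤ ∫⁻ x in Nᶜ, ∫⁻ y in R, ENNReal.ofReal (A * 2 ^ E) *
          (t * (‖v (dyadicIndex k x) - v (dyadicIndex k y)‖ₑ ^ 2 *
            ENNReal.ofReal (bracketKernel n γ ρ (x - y))) + (t : ENNReal)⁻¹ *
            (ENNReal.ofReal (bracketKernel n γ ρ (x - y)) * ‖h y‖ₑ ^ 2)) := by
          refine lintegral_mono_ae ?_
          filter_upwards [ae_restrict_of_ae (hK.enorm_apply_le_of_far hA0 hn hγ hsupp h0),
            ae_restrict_mem measurableSet_ball.compl] with x hx hxN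
          rw [hN, Set.mem_compl_iff, Metric.mem_ball, not_lt] at hxN
          refine (mul_le_mul_right (hx hxN) _).trans ?_
          rw [← lintegral_const_mul' _ _ enorm_ne_top]
          refine setLIntegral_mono' (measurableSet_dyadicCube j m) fun y hy => ?_
          rw [ENNReal.ofReal_mul (by positivity), hRc y hy]
          calc _ = ENNReal.ofReal (A * 2 ^ E) * (ENNReal.ofReal (bracketKernel n γ ρ (x - y)) *
                (‖v (dyadicIndex k x) - a‖ₑ * ‖h y‖ₑ)) := by ring
            _ ≤ ENNReal.ofReal (A * 2 ^ E) * (ENNReal.ofReal (bracketKernel n γ ρ (x - y)) *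
                (t * ‖v (dyadicIndex k x) - a‖ₑ ^ 2 + (t : ENNReal)⁻¹ * ‖h y‖ₑ ^ 2)) := by
                gcongr
                exact ENNReal.mul_le_mul_sq_add_inv_mul_sq _ _ ht
            _ = _ := by ring
      _ ≤ ∫⁻ x, ∫⁻ y in R, ENNReal.ofReal (A * 2 ^ E) *
          (t * (‖v (dyadicIndex k x) - v (dyadicIndex k y)‖ₑ ^ 2 *
            ENNReal.ofReal (bracketKernel n γ ρ (x - y))) + (t : ENNReal)⁻¹ *
            (ENNReal.ofReal (bracketKernel n γ ρ (x - y)) * ‖h y‖ₑ ^ 2)) :=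
          setLIntegral_le_lintegral _ _
      _ = _ := by
          have hm1 : Measurable fun p : (Fin n → ℝ) × (Fin n → ℝ) =>
              ‖v (dyadicIndex k p.1) - v (dyadicIndex k p.2)‖ₑ ^ 2 *
                ENNReal.ofReal (bracketKernel n γ ρ (p.1 - p.2)) :=
            (((hvm.comp measurable_fst).sub (hvm.comp measurable_snd)).enorm.pow_const 2).mul
              (hP.comp (measurable_fst.sub measurable_snd))
          rw [lintegral_lintegral_mul_add_mul (μ := volume) (ν := volume.restrict R)
            (f := fun x y => ‖v (dyadicIndex k x) - v (dyadicIndex k y)‖ₑ ^ 2 *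
              ENNReal.ofReal (bracketKernel n γ ρ (x - y)))
            (g := fun x y => ENNReal.ofReal (bracketKernel n γ ρ (x - y)) * ‖h y‖ₑ ^ 2)
            hm1 ENNReal.ofReal_ne_top ENNReal.coe_ne_top
            (ENNReal.inv_ne_top.2 (by exact_mod_cast ht)),
            lintegral_lintegral_bracketKernel_mul hγ hρ0 ((measurable_enorm_Lp h).pow_const 2)]
  calc ‖inner ℂ F (T h)‖ₑ ≤ ∫⁻ x, ‖v (dyadicIndex k x) - a‖ₑ * ‖T h x‖ₑ := by
        rw [hinner]
        refine (enorm_integral_le_lintegral_enorm _).trans (lintegral_mono fun x => ?_)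
        rw [enorm_mul, RCLike.enorm_conj]
    _ = (∫⁻ x in N, ‖v (dyadicIndex k x) - a‖ₑ * ‖T h x‖ₑ) +
        ∫⁻ x in Nᶜ, ‖v (dyadicIndex k x) - a‖ₑ * ‖T h x‖ₑ :=
        (lintegral_add_compl _ measurableSet_ball).symm
    _ ≤ (t * (ENNReal.ofReal (4 ^ E) * I) + (t : ENNReal)⁻¹ * H) +
        ENNReal.ofReal (A * 2 ^ E) * (t * I +
        (t : ENNReal)⁻¹ * (ENNReal.ofReal (bracketConst n γ) * H)) := add_le_add hnear hfar
    _ = ENNReal.ofReal (4 ^ E + A * 2 ^ E) * (t * I) +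
        ENNReal.ofReal (1 + A * 2 ^ E * bracketConst n γ) * ((t : ENNReal)⁻¹ * H) := by
        rw [ENNReal.ofReal_add (by positivity) (by positivity), ENNReal.ofReal_add zero_le_one
          (by positivity), ENNReal.ofReal_mul (q := bracketConst n γ) (by positivity),
          ENNReal.ofReal_one]
        ring
    _ ≤ ENNReal.ofReal (A * pairingConst n γ) * (t * I) +
        ENNReal.ofReal (A * pairingConst n γ) * ((t : ENNReal)⁻¹ * H) := by
        -- `A ≥ 1` lets the near terms, which carry no `A`, be absorbed.
        have e4 : (0 : ℝ) < 4 ^ E := by positivity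
        have e2 : (0 : ℝ) < 2 ^ E := by positivity
        have e3 : 0 ≤ 2 ^ E * bracketConst n γ := by positivity
        gcongr <;> rw [pairingConst] <;> nlinarith
    _ = _ := by rw [mul_add]

end Local

/-! ### Averages of singular integrals of martingale differences -/

section Averages

variable {n : ℕ} {K : (Fin n → ℝ) → (Fin n → ℝ) → ℂ} {A γ : ℝ} {T : L2 n →L[ℂ] L2 n}

/-- The restriction of an `L₂` function to a dyadic cube. -/
noncomputable def cubeRestrict (j : ℤ) (m : Fin n → ℤ) (h : L2 n) : L2 n :=
  ((Lp.memLp h).indicator (measurableSet_dyadicCube j m)).toLp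

theorem coeFn_cubeRestrict (j : ℤ) (m : Fin n → ℤ) (h : L2 n) :
    cubeRestrict j m h =ᵐ[volume] (dyadicCube j m).indicator h :=
  MemLp.coeFn_toLp _

theorem cubeRestrict_ae_eq_zero (j : ℤ) (m : Fin n → ℤ) (h : L2 n) :
    ∀ᵐ y, y ∉ dyadicCube j m → cubeRestrict j m h y = 0 := by
  filter_upwards [coeFn_cubeRestrict j m h] with y hy hyR
  rw [hy, Set.indicator_of_notMem hyR]

theorem integral_cubeRestrict {j : ℤ} {h : L2 n} (hh : dyadicExp n j h = 0) (m : Fin n → ℤ) :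
    ∫ y, cubeRestrict j m h y = 0 := by
  classical
  have h1 : ∀ y, (dyadicCube j m).indicator (fun _ => (1 : ℂ)) y =
      (fun l => if l = m then 1 else 0) (dyadicIndex j y) := fun y => by
    simp only [Set.indicator_apply, mem_dyadicCube_iff]
  have h2 : StronglyMeasurable[dyadicSigma n j]
      ((dyadicCube j m).indicator fun _ => (1 : ℂ)) := by
    rw [funext h1]
    exact stronglyMeasurable_comp_dyadicIndex j fun l => if l = m then (1 : ℂ) else 0
  have h3 : MemLp ((dyadicCube j m).indicator fun _ => (1 : ℂ)) 2 volume :=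
    memLp_indicator_const 2 (measurableSet_dyadicCube j m) 1
      (Or.inr (volume_dyadicCube_lt_top j m).ne)
  rw [← integral_mul_eq_zero_of_dyadicExp_eq_zero h2 h3 hh]
  refine integral_congr_ae ?_
  filter_upwards [coeFn_cubeRestrict j m h] with y hy
  rw [hy]
  by_cases hyR : y ∈ dyadicCube j m
  · rw [Set.indicator_of_mem hyR, Set.indicator_of_mem hyR, one_mul]
  · rw [Set.indicator_of_notMem hyR, Set.indicator_of_notMem hyR, zero_mul]

theorem exists_ae_eq_comp_dyadicIndex {k : ℤ} {F : L2 n} (hF : dyadicExp n k F = F) :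
    ∃ v : (Fin n → ℤ) → ℂ, F =ᵐ[volume] fun x => v (dyadicIndex k x) := by
  obtain ⟨F₀, hm, hae⟩ := aestronglyMeasurable_dyadicExp k F
  rw [hF] at hae
  refine ⟨fun m => F₀ (dyadicPoint k m), ?_⟩
  filter_upwards [hae] with x hx
  rw [hx]
  exact eq_of_dyadicIndex_eq hm (dyadicIndex_dyadicCorner k x).symm

/-- Being a step function of level `L`, `h` is bounded on the cube, so its restriction lies in the
Hardy space and `T*1 = 0` applies. -/
theorem integral_apply_cubeRestrict (hadj : AdjointKillsOne T) {j L : ℤ} {h : L2 n}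
    (hL : dyadicExp n L h = h) (hj : dyadicExp n j h = 0) (m : Fin n → ℤ) :
    ∫ x, T (cubeRestrict j m h) x = 0 := by
  obtain ⟨v, hv⟩ := exists_ae_eq_comp_dyadicIndex hL
  obtain ⟨M, hM⟩ := ((finite_dyadicIndex_image j L m).image fun l => ‖v l‖).bddAbove
  refine hadj _ (memHardyOne_of_bounded (c := dyadicPoint j m) (r := (2 : ℝ) ^ (-j))
    (M := max M 0) (by positivity) ?_ ?_
    (integrable_of_support_dyadicCube (cubeRestrict_ae_eq_zero j m h))
    (integral_cubeRestrict hj m))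
  · filter_upwards [cubeRestrict_ae_eq_zero j m h] with y hy hy'
    exact hy fun h => hy' (dyadicCube_subset_closedBall j m h)
  · filter_upwards [coeFn_cubeRestrict j m h, hv] with y hy1 hy2
    rw [hy1]
    by_cases hyR : y ∈ dyadicCube j m
    · rw [Set.indicator_of_mem hyR, hy2]
      exact (hM ⟨_, ⟨y, hyR, rfl⟩, rfl⟩).trans (le_max_left _ _)
    · rw [Set.indicator_of_notMem hyR, norm_zero]
      exact le_max_right _ _

theorem hasSum_inner_cubeRestrict (j : ℤ) (b h : L2 n) :
    HasSum (fun m => inner ℂ b (cubeRestrict j m h)) (inner ℂ b h) := by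
  have h1 : Integrable (fun y => inner ℂ (b y) (h y)) volume := L2.integrable_inner b h
  have h2 := hasSum_integral_iUnion (f := fun y => inner ℂ (b y) (h y)) (μ := volume)
    (fun m => measurableSet_dyadicCube (n := n) j m)
    (pairwise_disjoint_dyadicCube j) h1.integrableOn
  rw [iUnion_dyadicCube, setIntegral_univ] at h2
  rw [MeasureTheory.L2.inner_def]
  refine h2.congr_fun fun m => ?_
  rw [MeasureTheory.L2.inner_def, ← integral_indicator (measurableSet_dyadicCube j m)]
  refine integral_congr_ae ?_
  filter_upwards [coeFn_cubeRestrict j m h] with y hy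
  rw [hy]
  by_cases hyR : y ∈ dyadicCube j m
  · rw [Set.indicator_of_mem hyR, Set.indicator_of_mem hyR]
  · rw [Set.indicator_of_notMem hyR, Set.indicator_of_notMem hyR, inner_zero_right]

theorem tsum_setLIntegral_dyadicCube (j : ℤ) (u : (Fin n → ℝ) → ENNReal) :
    ∑' m, ∫⁻ y in dyadicCube j m, u y = ∫⁻ y, u y := by
  rw [← lintegral_iUnion (fun m => measurableSet_dyadicCube j m) (pairwise_disjoint_dyadicCube j),
    iUnion_dyadicCube, setLIntegral_univ]

/-- The constant in the fractional Sobolev bound for dyadic step functions. -/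
noncomputable def stepConst (n : ℕ) (γ : ℝ) : ℝ :=
  4 * n ^ (γ / 2) * bracketConst n (γ / 2) + 1

theorem IsCalderonZygmund.norm_sq_dyadicExp_apply_le (hK : IsCalderonZygmund γ A K T)
    (hA : 1 ≤ A) (hn : 1 ≤ n) (hγ0 : 0 < γ) (hγ1 : γ ≤ 1) (hT : ‖T‖ ≤ 1)
    (hadj : AdjointKillsOne T) {j k L : ℤ} (hkj : k ≤ j) {h : L2 n}
    (hL : dyadicExp n L h = h) (hj : dyadicExp n j h = 0) :
    ‖dyadicExp n k (T h)‖ ^ 2 ≤ 4 * (A * pairingConst n γ) ^ 2 *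
      (stepConst n γ * ((2 : ℝ) ^ (-j) / 2 ^ (-k)) ^ (γ / 2)) * ‖h‖ ^ 2 := by
  set F := dyadicExp n k (T h) with hFdef
  set ρ : ℝ := 2 ^ (-j) with hρ
  have hρ0 : 0 < ρ := by positivity
  have hb := bracketConst_nonneg n γ
  have hb2 := bracketConst_nonneg n (γ / 2)
  -- The summand 1 in `stepConst` secures `κ > 0`, by which `τ` divides.
  have hS : 0 < stepConst n γ := by unfold stepConst; positivity
  have hP : 0 < pairingConst n γ := by unfold pairingConst; positivity
  set κ : ℝ := stepConst n γ * (ρ / 2 ^ (-k)) ^ (γ / 2) with hκ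
  have hκ0 : 0 < κ := by positivity
  set a : ℝ := A * pairingConst n γ with ha
  have ha0 : 0 < a := by positivity
  obtain ⟨v, hv⟩ := exists_ae_eq_comp_dyadicIndex (dyadicExp_dyadicExp_of_le le_rfl (T h))
  -- Chosen so that `a τ κ ‖F‖² = ‖F‖²/2`, which is absorbed on the left.
  set τ : ℝ := 1 / (2 * a * κ) with hτ
  have hτ0 : 0 < τ := by positivity
  set t : NNReal := τ.toNNReal with ht
  have ht0 : t ≠ 0 := (Real.toNNReal_pos.2 hτ0).ne'
  have htE : (t : ENNReal) = ENNReal.ofReal τ := rfl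
  have hpair := fun m => hK.enorm_inner_apply_le hA hn hγ0 hT hkj (m := m)
    (cubeRestrict_ae_eq_zero j m h) (integral_cubeRestrict hj m)
    (integral_apply_cubeRestrict hadj hL hj m) hv ht0
  have hcube : ∀ m, ∫⁻ y in dyadicCube j m, ‖cubeRestrict j m h y‖ₑ ^ 2 =
      ∫⁻ y in dyadicCube j m, ‖h y‖ₑ ^ 2 := by
    intro m
    refine lintegral_congr_ae ?_
    filter_upwards [ae_restrict_of_ae (coeFn_cubeRestrict j m h),
      ae_restrict_mem (measurableSet_dyadicCube j m)] with y hy hyR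
    rw [hy, Set.indicator_of_mem hyR]
  have hsum : HasSum (fun m => inner ℂ F (T (cubeRestrict j m h))) (inner ℂ F (T h)) := by
    simp_rw [← ContinuousLinearMap.adjoint_inner_left]
    exact hasSum_inner_cubeRestrict j _ h
  have hFF : inner ℂ F (T h) = ((‖F‖ ^ 2 : ℝ) : ℂ) := by
    have h1 : dyadicExp n k F = F := dyadicExp_dyadicExp_of_le le_rfl (T h)
    rw [← h1, inner_dyadicExp_left, h1, ← hFdef, inner_self_eq_norm_sq_to_K, Complex.ofReal_pow]
    rfl
  have hmain : ENNReal.ofReal (‖F‖ ^ 2) ≤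
      ENNReal.ofReal (a * (τ * (κ * ‖F‖ ^ 2) + τ⁻¹ * ‖h‖ ^ 2)) := by
    calc ENNReal.ofReal (‖F‖ ^ 2) = ‖inner ℂ F (T h)‖ₑ := by
          rw [hFF, ← ofReal_norm, Complex.norm_real, Real.norm_of_nonneg (by positivity)]
      _ ≤ ∑' m, ‖inner ℂ F (T (cubeRestrict j m h))‖ₑ := by
          rw [← hsum.tsum_eq]
          exact enorm_tsum_le_tsum_enorm
      _ ≤ ∑' m, ENNReal.ofReal a *
          (t * (∫⁻ y in dyadicCube j m, ∫⁻ x, ‖v (dyadicIndex k x) - v (dyadicIndex k y)‖ₑ ^ 2 *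
            ENNReal.ofReal (bracketKernel n γ ρ (x - y))) +
            (t : ENNReal)⁻¹ * ∫⁻ y in dyadicCube j m, ‖h y‖ₑ ^ 2) := by
          refine ENNReal.tsum_le_tsum fun m => ?_
          rw [← hcube m]
          exact hpair m
      _ = ENNReal.ofReal a *
          (t * (∫⁻ y, ∫⁻ x, ‖v (dyadicIndex k x) - v (dyadicIndex k y)‖ₑ ^ 2 *
            ENNReal.ofReal (bracketKernel n γ ρ (x - y))) +
            (t : ENNReal)⁻¹ * ∫⁻ y, ‖h y‖ₑ ^ 2) := by
          rw [ENNReal.tsum_mul_left, ENNReal.tsum_add, ENNReal.tsum_mul_left,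
            ENNReal.tsum_mul_left, tsum_setLIntegral_dyadicCube, tsum_setLIntegral_dyadicCube]
      _ ≤ ENNReal.ofReal a * (t * (ENNReal.ofReal κ * ENNReal.ofReal (‖F‖ ^ 2)) +
            (t : ENNReal)⁻¹ * ENNReal.ofReal (‖h‖ ^ 2)) := by
          rw [norm_sq_eq_lintegral h, norm_sq_eq_lintegral F]
          have hFv : ∫⁻ y, ‖F y‖ₑ ^ 2 = ∫⁻ y, ‖v (dyadicIndex k y)‖ₑ ^ 2 := by
            refine lintegral_congr_ae ?_
            filter_upwards [hv] with y hy
            rw [hy]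
          rw [hFv]
          have hstep := lintegral_lintegral_enorm_sub_sq_bracketKernel_le hγ0 hγ1 hρ0 k v
          have hκle : 4 * n ^ (γ / 2) * bracketConst n (γ / 2) * (ρ / 2 ^ (-k)) ^ (γ / 2) ≤ κ := by
            rw [hκ, stepConst]
            gcongr
            linarith
          gcongr
          exact hstep.trans (mul_le_mul_left (ENNReal.ofReal_le_ofReal hκle) _)
      _ = _ := by
          rw [htE, ← ENNReal.ofReal_inv_of_pos hτ0, ← ENNReal.ofReal_mul hκ0.le,
            ← ENNReal.ofReal_mul hτ0.le, ← ENNReal.ofReal_mul (by positivity),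
            ← ENNReal.ofReal_add (by positivity) (by positivity), ← ENNReal.ofReal_mul ha0.le]
  rw [ENNReal.ofReal_le_ofReal_iff (by positivity)] at hmain
  have e1 : a * (τ * (κ * ‖F‖ ^ 2) + τ⁻¹ * ‖h‖ ^ 2) =
      ‖F‖ ^ 2 / 2 + 2 * a ^ 2 * κ * ‖h‖ ^ 2 := by
    rw [hτ]
    field_simp
  rw [e1] at hmain
  linarith

/-- The constant in the bound for `E_k T Δ_{k+d}`. -/
noncomputable def averageConst (n : ℕ) (γ : ℝ) : ℝ :=
  2 * pairingConst n γ * √(stepConst n γ * 2 ^ (γ / 2))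

theorem averageConst_nonneg (n : ℕ) (γ : ℝ) : 0 ≤ averageConst n γ := by
  have hb := bracketConst_nonneg n γ
  unfold averageConst pairingConst
  positivity

/-- The mean-zero level is `j = k + d - 1`, so the ratio of side lengths is `2·2^{-d}`; the square
root turns its power `γ/2` into `γ/4`. -/
theorem IsCalderonZygmund.norm_dyadicExp_apply_dyadicDiff_le (hK : IsCalderonZygmund γ A K T)
    (hA : 1 ≤ A) (hn : 1 ≤ n) (hγ0 : 0 < γ) (hγ1 : γ ≤ 1) (hT : ‖T‖ ≤ 1)
    (hadj : AdjointKillsOne T) (k : ℤ) {d : ℕ} (hd : 1 ≤ d) (f : L2 n) :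
    ‖dyadicExp n k (T (dyadicDiff n (k + d) f))‖ ≤
      averageConst n γ * A * ((2 : ℝ) ^ (-(γ / 4))) ^ d * ‖dyadicDiff n (k + d) f‖ := by
  have hC := averageConst_nonneg n γ
  have hb2 := bracketConst_nonneg n (γ / 2)
  have hS : 0 < stepConst n γ := by unfold stepConst; positivity
  have h1 := hK.norm_sq_dyadicExp_apply_le hA hn hγ0 hγ1 hT hadj (j := k + d - 1) (k := k)
    (L := k + d) (by omega) (dyadicExp_dyadicDiff_of_le le_rfl f)
    (dyadicExp_dyadicDiff_of_lt (by omega) f)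
  refine le_of_sq_le_sq (h1.trans (le_of_eq ?_)) (by positivity)
  have e1 : (2 : ℝ) ^ (-(k + (d : ℤ) - 1)) / 2 ^ (-k) = 2 * 2 ^ (-(d : ℤ)) := by
    rw [show -(k + (d : ℤ) - 1) = -k + 1 + -(d : ℤ) by ring, zpow_add₀ two_ne_zero,
      zpow_add₀ two_ne_zero, zpow_one]
    have : (2 : ℝ) ^ (-k) ≠ 0 := by positivity
    field_simp
  have e2 : ((2 : ℝ) ^ (-(d : ℤ))) ^ (γ / 2) = (((2 : ℝ) ^ (-(γ / 4))) ^ d) ^ 2 := by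
    rw [two_zpow_neg_rpow, ← Real.rpow_natCast, ← Real.rpow_natCast, ← Real.rpow_natCast,
      ← Real.rpow_mul two_pos.le, ← Real.rpow_mul two_pos.le, ← Real.rpow_mul two_pos.le]
    congr 1
    push_cast
    ring
  rw [e1, Real.mul_rpow two_pos.le (by positivity), e2, averageConst, mul_pow, mul_pow, mul_pow,
    mul_pow, mul_pow, Real.sq_sqrt (by positivity)]
  ring

/-- Testing the finer term at level `i` widens the gap between its average and its martingale
difference by `j - i`; this is the off-diagonal decay. -/
theorem inner_dyadicExp_dyadicExp_of_le {i j : ℤ} (hij : i ≤ j) (f g : L2 n) :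
    inner ℂ (dyadicExp n i f) (dyadicExp n j g) =
      inner ℂ (dyadicExp n i f) (dyadicExp n i g) := by
  rw [← inner_dyadicExp_left j, dyadicExp_dyadicExp_of_le hij, ← inner_dyadicExp_left i,
    dyadicExp_dyadicExp_of_le le_rfl]

/-- Pseudolocalization for Calderón–Zygmund operators with `T*1 = 0`. -/
theorem IsCalderonZygmund.exists_hasSum_averages (hK : IsCalderonZygmund γ A K T)
    (hA : 1 ≤ A) (hn : 1 ≤ n) (hγ0 : 0 < γ) (hγ1 : γ ≤ 1) (hT : ‖T‖ ≤ 1)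
    (hadj : AdjointKillsOne T) {s : ℕ} (hs : 1 ≤ s) :
    ∃ Φ : L2 n →L[ℂ] L2 n,
      (∀ f : L2 n, HasSum (fun k : ℤ => dyadicExp n k (T (dyadicDiff n (k + s) f))) (Φ f)) ∧
      ‖Φ‖ ≤ √(2 / (1 - 2 ^ (-(γ / 4)))) * averageConst n γ * A * (2 : ℝ) ^ (-(γ * s / 4)) := by
  have hC := averageConst_nonneg n γ
  obtain ⟨hr0, hr1⟩ := two_rpow_neg_mem_Ioo (show 0 < γ / 4 by positivity)
  have hr1' : 0 < 1 - (2 : ℝ) ^ (-(γ / 4)) := by linarith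
  set q : ℝ := 2 ^ (-(γ / 4)) with hq
  have hqs : (2 : ℝ) ^ (-(γ * s / 4)) = q ^ s := by
    rw [hq, ← Real.rpow_natCast, ← Real.rpow_mul two_pos.le]
    congr 1
    ring
  -- Here both factors are small in `s`, so the root of `B` keeps the whole `q^s`.
  set B : ℝ := (averageConst n γ * A * q ^ s) ^ 2 with hB
  have hM : 2 * B / (1 - q) ≤
      (√(2 / (1 - q)) * averageConst n γ * A * (2 : ℝ) ^ (-(γ * s / 4))) ^ 2 := by
    rw [hqs, hB, mul_pow, mul_pow, mul_pow, mul_pow, mul_pow, Real.sq_sqrt (by positivity)]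
    apply le_of_eq
    ring
  exact exists_hasSum_of_almostOrthogonal
    (Λ := fun k => (dyadicExp n k).comp (T.comp (dyadicDiff n (k + s))))
    (D := fun k => dyadicDiff n (k + s)) (B := B) (r := q) (by positivity) hr0.le hr1
    (by positivity) hM
    (fun S f => by
      have := sum_norm_sq_dyadicDiff_le (S.map (addRightEmbedding (s : ℤ))) f
      rw [Finset.sum_map] at this
      exact this)
    (fun i j hij f => by
      obtain ⟨d, rfl⟩ := Int.le.dest hij
      have e : (i - (i + (d : ℤ))).natAbs = d := by omega
      rw [e]
      change ‖inner ℂ (dyadicExp n i (T (dyadicDiff n (i + s) f)))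
        (dyadicExp n (i + d) (T (dyadicDiff n (i + d + s) f)))‖ ≤ _
      rw [inner_dyadicExp_dyadicExp_of_le hij]
      have h1 := hK.norm_dyadicExp_apply_dyadicDiff_le hA hn hγ0 hγ1 hT hadj i hs f
      have h2 := hK.norm_dyadicExp_apply_dyadicDiff_le hA hn hγ0 hγ1 hT hadj i
        (show 1 ≤ d + s by omega) f
      rw [Nat.cast_add, ← add_assoc] at h2
      refine (norm_inner_le_norm _ _).trans ((mul_le_mul h1 h2 (norm_nonneg _)
        (by positivity)).trans (le_of_eq ?_))
      rw [hB]
      ring)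

end Averages

/-! ### ### The two pseudolocalization bounds together -/

theorem mainTheorem5 (n : ℕ) (hn : 1 ≤ n) (γ : ℝ) (hγ0 : 0 < γ) (hγ1 : γ ≤ 1) :
    ∃ c : ℝ, ∀ (A : ℝ), 1 ≤ A →
      ∀ (K : (Fin n → ℝ) → (Fin n → ℝ) → ℂ) (T : L2 n →L[ℂ] L2 n),
        IsCalderonZygmund γ A K T → ‖T‖ ≤ 1 →
        ∀ s : ℕ, 1 ≤ s →
          (AdjointKillsOne T →
            ∃ Φ : L2 n →L[ℂ] L2 n,
              (∀ f : L2 n,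
                HasSum (fun k : ℤ => dyadicExp n k (T (dyadicDiff n (k + s) f))) (Φ f)) ∧
              ‖Φ‖ ≤ c * A * s * (2 : ℝ) ^ (-(γ * s / 4))) ∧
          (∃ Ψ : L2 n →L[ℂ] L2 n,
              (∀ f : L2 n, ∃ g : ℤ → L2 n,
                (∀ k : ℤ, IsTruncatedIntegral K (4 * (2 : ℝ) ^ (-k))
                  (dyadicDiff n (k + s) f) (g k)) ∧
                HasSum (fun k : ℤ => g k - dyadicExp n k (g k)) (Ψ f)) ∧
              ‖Ψ‖ ≤ c * A * (2 : ℝ) ^ (-(γ * s / 2))) := by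
  set c₁ := √(2 / (1 - 2 ^ (-(γ / 4)))) * averageConst n γ with hc₁
  set c₂ := √(2 / (1 - 2 ^ (-γ))) * shellConst n γ with hc₂
  have h₁ : 0 ≤ c₁ := mul_nonneg (Real.sqrt_nonneg _) (averageConst_nonneg n γ)
  have h₂ : 0 ≤ c₂ := mul_nonneg (Real.sqrt_nonneg _) (shellConst_nonneg n γ)
  refine ⟨c₁ + c₂, fun A hA K T hK hT s hs => ⟨fun hadj => ?_, ?_⟩⟩
  · obtain ⟨Φ, hΦ, hΦn⟩ := hK.exists_hasSum_averages hA hn hγ0 hγ1 hT hadj hs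
    refine ⟨Φ, hΦ, hΦn.trans ?_⟩
    -- The bound obtained for `Φ` has no factor `s`; it is inserted for free.
    have hs' : (1 : ℝ) ≤ s := by exact_mod_cast hs
    refine mul_le_mul_of_nonneg_right ?_ (by positivity)
    calc c₁ * A ≤ (c₁ + c₂) * A := mul_le_mul_of_nonneg_right (by linarith) (by linarith)
      _ ≤ (c₁ + c₂) * A * s :=
          le_mul_of_one_le_right (mul_nonneg (by linarith) (by linarith)) hs'
  · obtain ⟨Ψ, hΨ, hΨn⟩ := hK.exists_hasSum_truncated (by linarith) hn hγ0 hγ1 hs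
    refine ⟨Ψ, hΨ, hΨn.trans ?_⟩
    refine mul_le_mul_of_nonneg_right ?_ (by positivity)
    exact mul_le_mul_of_nonneg_right (by linarith) (by linarith)
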